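/- Let $\widetilde G$ be the piecewise $PSL_2(\mathbb Z)$ group: the group, under composition, of all homeomorphisms $f$ of $\mathbb R\cup\{\infty\}$ that fix $\infty$ (equivalently, are viewed as homeomorphisms of the real line) and are piecewise in $PSL_2(\mathbb Z)$ with finitely many pieces, that is, for some finite set $S\subset\mathbb R$, on each connected component of $\mathbb R\setminus S$ the map $f$ coincides with $x\mapsto\frac{px+q}{rx+t}$ for some $\begin{pmatrix}p&q\\r&t\end{pmatrix}\in SL_2(\mathbb Z)$ depending on the component. Let $P_{\mathbb Z}\subset\mathbb R$ be the set of fixed points of hyperbolic elements of $PSL_2(\mathbb Z)$ (those whose trace has absolute value greater than $2$), and for a homeomorphism $f$ of $\mathbb R$ put $\operatorname{supp}(f)=\{x\in\mathbb R: f(x)\neq x\}$. **Lemma.** Let $H$ be a finitely generated subgroup of $\widetilde G$. Then $H$ is solvable, or there exist $f,g\in H$ and $b,c,s\in\mathbb R$ such that 1. $b<c$, $g(b)=b$, $f(c)=c$, $(b,c]\subset\operatorname{supp}(g)$ and $[b,c)\subset\operatorname{supp}(f)$; 2. $s\in P_{\mathbb Z}\cup\mathbb Q$, $s\le b$, and $f^n(s)\in[b,c]$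 for some $n\in\mathbb Z$; 3. there is $\varepsilon_s>0$ such that $g(s-\varepsilon)=s-\varepsilon$ and $g(s+\varepsilon)\neq s+\varepsilon$ for every $0<\varepsilon\le\varepsilon_s$. -/

import Mathlib

open Matrix Set
open scoped MatrixGroups OnePoint

namespace PiecewisePSL

/-- The projective action of an integer matrix of determinant one on `ℝ ∪ {∞}`, i.e.
`x ↦ (a * x + b) / (c * x + d)` with the usual conventions at `∞` and at the pole.
A matrix and its negative act in the same way, so these are the maps defined by `PSL₂(ℤ)`. -/
noncomputable def mob (γ : SL(2, ℤ)) (x : OnePoint ℝ) : OnePoint ℝ :=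
  Matrix.SpecialLinearGroup.mapGL ℝ γ • x

/-- A self-homeomorphism of the real line (a homeomorphism of `ℝ ∪ {∞}` that fixes `∞`) is
piecewise in `PSL₂(ℤ)` if, for some finite set `S` of points, on every connected subset of the
complement of `S` it coincides with a single element of `PSL₂(ℤ)`. The point `∞` is always allowed
as an end of pieces, so the germs at `-∞` and at `+∞` may differ. -/
def IsPiecewisePSL (f : ℝ ≃ₜ ℝ) : Prop :=
  ∃ S : Set ℝ, S.Finite ∧ ∀ U : Set ℝ, IsPreconnected U → U ⊆ Sᶜ →
    ∃ γ : SL(2, ℤ), ∀ x ∈ U, ((f x : ℝ) : OnePoint ℝ) = mob γ (x : OnePoint ℝ)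

/-- The piecewise `PSL₂(ℤ)` group, seen as a group of homeomorphisms of the real line
(the group law is composition). -/
def piecewiseGroup : Subgroup (ℝ ≃ₜ ℝ) where
  carrier := {f | IsPiecewisePSL f}
  one_mem' := ⟨∅, finite_empty, fun _ _ _ => ⟨1, fun x _ => by simp [mob]⟩⟩
  mul_mem' := by
    rintro f g ⟨S, hS, hf⟩ ⟨T, hT, hg⟩
    refine ⟨T ∪ g ⁻¹' S, hT.union (hS.preimage g.injective.injOn), fun U hU hUS => ?_⟩
    obtain ⟨γ, hγ⟩ := hg U hU fun x hx h => hUS hx (Or.inl h)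
    obtain ⟨δ, hδ⟩ := hf (g '' U) (hU.image g g.continuous.continuousOn) (by
      rintro _ ⟨x, hx, rfl⟩ h
      exact hUS hx (Or.inr h))
    refine ⟨δ * γ, fun x hx => ?_⟩
    have h1 := hδ (g x) (mem_image_of_mem g hx)
    rw [hγ x hx] at h1
    simpa [mob, mul_smul] using h1
  inv_mem' := by
    rintro f ⟨S, hS, hf⟩
    refine ⟨f '' S, hS.image f, fun U hU hUS => ?_⟩
    obtain ⟨γ, hγ⟩ := hf (f.symm '' U) (hU.image _ f.symm.continuous.continuousOn) (by
      rintro _ ⟨x, hx, rfl⟩ h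
      exact hUS hx ⟨_, h, f.apply_symm_apply x⟩)
    refine ⟨γ⁻¹, fun x hx => ?_⟩
    have h1 := hγ (f.symm x) (mem_image_of_mem _ hx)
    rw [f.apply_symm_apply] at h1
    simp only [mob, map_inv] at h1 ⊢
    rw [h1, inv_smul_smul]
    rfl

/-- The set `P_ℤ` of the points fixed by some hyperbolic element of `PSL₂(ℤ)`, i.e. by an element
whose trace is greater than `2` in absolute value. -/
def hyperbolicPoints : Set ℝ :=
  {s | ∃ γ : SL(2, ℤ), 2 < |(γ : Matrix (Fin 2) (Fin 2) ℤ).trace| ∧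
    mob γ (s : OnePoint ℝ) = (s : OnePoint ℝ)}

/-- The (non-closed) support of a homeomorphism of the line: the set of the points it moves. -/
def supp (f : ℝ ≃ₜ ℝ) : Set ℝ := {x | f x ≠ x}

/-- The configuration of `f`, `g` and the points `b`, `c`, `s`: the supports overlap along `[b, c]`
as in a chain, and `s` is a point of `P_ℤ ∪ ℚ` with `s ≤ b`, brought into `[b, c]` by a power
of `f`, such that near `s` the map `g` fixes every point to the left of `s` and moves every point
to the right of `s`. -/
structure IsChainConfiguration (f g : ℝ ≃ₜ ℝ) (b c s : ℝ) : Prop where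
  b_lt_c : b < c
  g_fix : g b = b
  f_fix : f c = c
  subset_supp_g : Ioc b c ⊆ supp g
  subset_supp_f : Ico b c ⊆ supp f
  s_mem : s ∈ hyperbolicPoints ∪ range ((↑) : ℚ → ℝ)
  s_le_b : s ≤ b
  pow_mem : ∃ n : ℤ, (f ^ n) s ∈ Icc b c
  slope_change : ∃ εs : ℝ, 0 < εs ∧
    ∀ ε : ℝ, 0 < ε → ε ≤ εs → g (s - ε) = s - ε ∧ g (s + ε) ≠ s + ε

end PiecewisePSL

/-! Suppose that no configuration exists; solvability becomes a matter of order dynamics. On the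
compact line `EReal` the group is tame (`isTame_of_not_chain`): one-sided germs at a fixed point
form a cyclic group, because point stabilizers in PSL₂(ℤ) are cyclic, and if g starts at s (identity
just left of s, moving points just right of s) while f moves all of [s, q) and fixes q, then g fixes
q.

Let (a, d) be a component of a finitely generated subgroup H of a tame group G, and K the elements
of H trivial just right of a. If f in H moves the points just right of a and has a fixed point in
(a, d), the first such point is fixed by all of K (`exists_germKernel_fixed`), since otherwise an
element of K would start before it and form a chain with f. Hence a generator h of the germs at a
has no fixed point in (a, d): the first one would be fixed by H = ⟨h⟩K. So h acts as a translation
and H/K is cyclic. The same principle shows that elements of K are trivial near d and that K has a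
fixed point in (a, d), so the components of K inside are relatively compact. On each of them K acts
through a finitely generated group L, because K is generated by the h-conjugates of finitely many
elements, and only finitely many conjugates are felt there.

Induct on the number of H-orbits containing the starts of elements of G in (a, d); it is finite
because starts lie in orbits of breakpoints of generators (`exists_finset_starts`). If K is
nontrivial there, it fixes a start of one of its elements (`exists_fixed_start`). The H-orbit of
that start is fixed by K, so it misses every component of K, while any other H-orbit meets such a
component in at most one L-orbit. So L needs one orbit fewer, and [H, H] ≤ K. -/

section

open Filter Topology

namespace OrderGerm

/-! ### Fixed points, orbits and components of order automorphisms -/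

section Order

variable {X : Type*} [CompleteLinearOrder X]

theorem inv_apply_eq_self_iff (g : X ≃o X) (x : X) : g⁻¹ x = x ↔ g x = x :=
  ⟨fun h => by rw [← h, RelIso.apply_inv_self, h], fun h => by rw [← h, RelIso.inv_apply_self, h]⟩

theorem sSup_fixed {g : X ≃o X} {S : Set X} (h : ∀ z ∈ S, g z = z) : g (sSup S) = sSup S := by
  rw [OrderIso.map_sSup, sSup_eq_iSup]
  exact iSup_congr fun z => iSup_congr (h z)

theorem sInf_fixed {g : X ≃o X} {S : Set X} (h : ∀ z ∈ S, g z = z) : g (sInf S) = sInf S := by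
  rw [OrderIso.map_sInf, sInf_eq_iInf]
  exact iInf_congr fun z => iInf_congr (h z)

theorem mem_Ioo_of_fixed {g : X ≃o X} {a d x : X} (ha : g a = a) (hd : g d = d)
    (hx : x ∈ Ioo a d) : g x ∈ Ioo a d := by
  constructor
  · rw [← ha]; exact g.strictMono hx.1
  · rw [← hd]; exact g.strictMono hx.2

theorem mem_Icc_of_fixed {g : X ≃o X} {a d x : X} (ha : g a = a) (hd : g d = d)
    (hx : x ∈ Icc a d) : g x ∈ Icc a d := by
  constructor
  · rw [← ha]; exact g.monotone hx.1
  · rw [← hd]; exact g.monotone hx.2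

theorem eventually_zpow {l : Filter X} {f g : X ≃o X} (hg : Tendsto g l l)
    (hg' : Tendsto (g⁻¹ : X ≃o X) l l) (h : ∀ᶠ z in l, f z = g z) (n : ℤ) :
    ∀ᶠ z in l, (f ^ n) z = (g ^ n) z := by
  have key : ∀ {f g : X ≃o X}, Tendsto g l l → (∀ᶠ z in l, f z = g z) → ∀ n : ℕ,
      ∀ᶠ z in l, (f ^ n) z = (g ^ n) z := by
    intro f g hg h n
    induction n with
    | zero => simp
    | succ n ih =>
      filter_upwards [h, hg.eventually ih] with z h1 h2
      rw [pow_succ, pow_succ, RelIso.mul_apply, RelIso.mul_apply, h1, h2]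
  obtain ⟨n, rfl | rfl⟩ := n.eq_nat_or_neg
  · simpa using key hg h n
  · have h' : ∀ᶠ z in l, f⁻¹ z = g⁻¹ z := by
      filter_upwards [hg'.eventually h] with z hz
      rw [RelIso.apply_inv_self] at hz
      rw [← hz, RelIso.inv_apply_self, hz]
    simpa using key hg' h' n

/-- The supremum m of the orbit of p satisfies h m ≤ m, so it cannot lie inside the interval, where
h moves every point up. -/
theorem exists_lt_pow {h : X ≃o X} {a d p r : X} (hh : ∀ x ∈ Ioo a d, x < h x) (hp : p ∈ Ioo a d)
    (hr : r < d) : ∃ n : ℕ, r < (h ^ n) p := by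
  refine lt_iSup_iff.1 (hr.trans_le ?_)
  by_contra! hm
  set m := ⨆ n : ℕ, (h ^ n) p with hm_def
  have h1 : p ≤ m := le_iSup (fun n : ℕ => (h ^ n) p) 0
  have h2 := hh m ⟨hp.1.trans_le h1, hm⟩
  refine absurd h2 (not_lt.2 ?_)
  rw [hm_def, OrderIso.map_iSup]
  refine iSup_le fun n => ?_
  rw [← RelIso.mul_apply, ← pow_succ']
  exact le_iSup (fun n : ℕ => (h ^ n) p) (n + 1)

theorem zpow_fixed {h : X ≃o X} {a : X} (ha : h a = a) (n : ℤ) : (h ^ n) a = a := by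
  have : ∀ n : ℕ, (h ^ n) a = a := fun n => by
    induction n with
    | zero => rfl
    | succ n ih => rw [pow_succ, RelIso.mul_apply, ha, ih]
  obtain ⟨n, rfl | rfl⟩ := n.eq_nat_or_neg
  · simpa using this n
  · rw [_root_.zpow_neg, zpow_natCast, inv_apply_eq_self_iff, this n]

theorem lt_pow_apply {h : X ≃o X} {a d x : X} (hh : ∀ x ∈ Ioo a d, x < h x) (ha : h a = a)
    (hd : h d = d) (hx : x ∈ Ioo a d) {n : ℕ} (hn : n ≠ 0) : x < (h ^ n) x := by
  obtain ⟨n, rfl⟩ := Nat.exists_eq_succ_of_ne_zero hn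
  clear hn
  induction n with
  | zero => simpa using hh x hx
  | succ n ih =>
    refine ih.trans ?_
    rw [pow_succ' _ (n + 1), RelIso.mul_apply]
    refine hh _ ?_
    have h1 := zpow_fixed ha (n + 1 : ℕ)
    have h2 := zpow_fixed hd (n + 1 : ℕ)
    rw [zpow_natCast] at h1 h2
    exact mem_Ioo_of_fixed h1 h2 hx

theorem zpow_apply_ne {h : X ≃o X} {a d x : X} (hh : ∀ x ∈ Ioo a d, x < h x) (ha : h a = a)
    (hd : h d = d) (hx : x ∈ Ioo a d) {n : ℤ} (hn : n ≠ 0) : (h ^ n) x ≠ x := by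
  obtain ⟨n, rfl | rfl⟩ := n.eq_nat_or_neg
  · simpa using (lt_pow_apply hh ha hd hx (by simpa using hn)).ne'
  · rw [_root_.zpow_neg, zpow_natCast, Ne, inv_apply_eq_self_iff]
    exact (lt_pow_apply hh ha hd hx (by simpa using hn)).ne'

/-- `(a, d)` is a connected component of the set of points moved by `H`. -/
structure IsComponent (H : Subgroup (X ≃o X)) (a d : X) : Prop where
  lt : a < d
  left_fixed : ∀ g ∈ H, g a = a
  right_fixed : ∀ g ∈ H, g d = d
  moved : ∀ x ∈ Ioo a d, ∃ g ∈ H, g x ≠ x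

/-- The ends are the nearest common fixed points on either side of x. They exist by completeness,
with `⊥` and `⊤` as the default values of an empty supremum and infimum. -/
theorem exists_isComponent {H : Subgroup (X ≃o X)} {x : X} (hx : ∃ g ∈ H, g x ≠ x) :
    ∃ a d, IsComponent H a d ∧ x ∈ Ioo a d := by
  obtain ⟨g, hg, hgx⟩ := hx
  set A := {y | y ≤ x ∧ ∀ g ∈ H, g y = y} with hA
  set D := {y | x ≤ y ∧ ∀ g ∈ H, g y = y} with hD
  have ha : ∀ g ∈ H, g (sSup A) = sSup A := fun g hg => sSup_fixed fun z hz => hz.2 g hg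
  have hd : ∀ g ∈ H, g (sInf D) = sInf D := fun g hg => sInf_fixed fun z hz => hz.2 g hg
  have hax : sSup A < x := lt_of_le_of_ne (sSup_le fun y hy => hy.1)
    fun h => hgx (by rw [← h]; exact ha g hg)
  have hxd : x < sInf D := lt_of_le_of_ne (le_sInf fun y hy => hy.1)
    fun h => hgx (by rw [h]; exact hd g hg)
  refine ⟨sSup A, sInf D, ⟨hax.trans hxd, ha, hd, fun y hy => ?_⟩, hax, hxd⟩
  by_contra! hcon
  rcases le_total y x with h | h
  · exact absurd hy.1 (not_lt.2 (le_sSup ⟨h, hcon⟩))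
  · exact absurd hy.2 (not_lt.2 (sInf_le ⟨h, hcon⟩))

end Order

variable {X : Type*} [CompleteLinearOrder X] [TopologicalSpace X] [OrderTopology X]

section Basic

theorem isClosed_fixed (g : X ≃o X) : IsClosed {x | g x = x} :=
  isClosed_eq g.continuous continuous_id

theorem fixed_right [DenselyOrdered X] {g : X ≃o X} {x y : X} (hxy : x < y)
    (h : ∀ z ∈ Ioo x y, g z = z) : g y = y := by
  have : closure (Ioo x y) ⊆ {z | g z = z} := closure_minimal h (isClosed_fixed g)
  rw [closure_Ioo hxy.ne] at this
  exact this ⟨hxy.le, le_rfl⟩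

theorem tendsto_nhdsGT {g : X ≃o X} {a : X} (ha : g a = a) : Tendsto g (𝓝[>] a) (𝓝[>] a) := by
  refine tendsto_nhdsWithin_iff.2 ⟨?_, ?_⟩
  · have := g.continuous.tendsto a
    rw [ha] at this
    exact this.mono_left nhdsWithin_le_nhds
  · filter_upwards [self_mem_nhdsWithin] with z hz
    rw [← ha]; exact g.strictMono hz

theorem tendsto_nhdsLT {g : X ≃o X} {a : X} (ha : g a = a) : Tendsto g (𝓝[<] a) (𝓝[<] a) := by
  refine tendsto_nhdsWithin_iff.2 ⟨?_, ?_⟩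
  · have := g.continuous.tendsto a
    rw [ha] at this
    exact this.mono_left nhdsWithin_le_nhds
  · filter_upwards [self_mem_nhdsWithin] with z hz
    rw [← ha]; exact g.strictMono hz

theorem exists_Ioo_right {a d : X} (had : a < d) {p : X → Prop} (h : ∀ᶠ z in 𝓝[>] a, p z) :
    ∃ e, a < e ∧ ∀ z ∈ Ioo a e, p z := by
  obtain ⟨e, he, h'⟩ := (mem_nhdsGT_iff_exists_Ioo_subset' had).1 h
  exact ⟨e, he, h'⟩

theorem exists_Ioo_left {a d : X} (had : a < d) {p : X → Prop} (h : ∀ᶠ z in 𝓝[<] d, p z) :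
    ∃ e, e < d ∧ ∀ z ∈ Ioo e d, p z := by
  obtain ⟨e, he, h'⟩ := (mem_nhdsLT_iff_exists_Ioo_subset' had).1 h
  exact ⟨e, he, h'⟩

/-- A homeomorphism without fixed points in an interval that it preserves moves all its points in
the same direction. -/
theorem moves_same_direction [DenselyOrdered X] {f : X ≃o X} {a d : X}
    (h : ∀ x ∈ Ioo a d, f x ≠ x) :
    (∀ x ∈ Ioo a d, x < f x) ∨ ∀ x ∈ Ioo a d, f x < x := by
  by_contra! hcon
  obtain ⟨⟨x, hx, hx'⟩, y, hy, hy'⟩ := hcon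
  obtain ⟨z, hz, hz'⟩ := (isPreconnected_Ioo (a := a) (b := d)).intermediate_value₂ hx hy
    f.continuous.continuousOn continuousOn_id hx' hy'
  exact h z hz hz'

end Basic

/-- `s` is the left end of a component of the support of `g`, and `g` is the identity on a left
neighborhood of `s`. -/
structure IsStart (g : X ≃o X) (s : X) : Prop where
  bot_lt : ⊥ < s
  left : ∀ᶠ z in 𝓝[<] s, g z = z
  right : ∀ᶠ z in 𝓝[>] s, g z ≠ z

/-- The group `G` has isolated fixed points up to intervals, cyclic groups of one-sided germs at its
fixed points, and no chains of supports that begin at the start of an element. -/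
structure IsTame (G : Subgroup (X ≃o X)) : Prop where
  right_dichotomy : ∀ g ∈ G, ∀ a, g a = a →
    (∀ᶠ z in 𝓝[>] a, g z = z) ∨ ∀ᶠ z in 𝓝[>] a, g z ≠ z
  left_dichotomy : ∀ g ∈ G, ∀ a, g a = a →
    (∀ᶠ z in 𝓝[<] a, g z = z) ∨ ∀ᶠ z in 𝓝[<] a, g z ≠ z
  right_cyclic : ∀ H ≤ G, ∀ a, (∀ g ∈ H, g a = a) →
    ∃ h ∈ H, ∀ g ∈ H, ∃ n : ℤ, ∀ᶠ z in 𝓝[>] a, g z = (h ^ n) z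
  left_cyclic : ∀ H ≤ G, ∀ a, (∀ g ∈ H, g a = a) →
    ∃ h ∈ H, ∀ g ∈ H, ∃ n : ℤ, ∀ᶠ z in 𝓝[<] a, g z = (h ^ n) z
  not_chain : ∀ f ∈ G, ∀ g ∈ G, ∀ s q, s < q → IsStart g s → (∀ z ∈ Ico s q, f z ≠ z) →
    f q = q → g q = q

/-- The elements of `H` that are the identity on a right neighborhood of `a`. -/
def germKernel (H : Subgroup (X ≃o X)) (a : X) : Subgroup (X ≃o X) where
  carrier := {g | g ∈ H ∧ ∀ᶠ z in 𝓝[>] a, g z = z}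
  one_mem' := ⟨H.one_mem, by simp⟩
  mul_mem' := by
    rintro f g ⟨hf, hf'⟩ ⟨hg, hg'⟩
    refine ⟨H.mul_mem hf hg, ?_⟩
    filter_upwards [hf', hg'] with z h1 h2
    rw [RelIso.mul_apply, h2, h1]
  inv_mem' := by
    rintro f ⟨hf, hf'⟩
    refine ⟨H.inv_mem hf, ?_⟩
    filter_upwards [hf'] with z h1
    rw [inv_apply_eq_self_iff, h1]

theorem germKernel_conj {H : Subgroup (X ≃o X)} {a : X} (hH : ∀ g ∈ H, g a = a) {g k : X ≃o X}
    (hg : g ∈ H) (hk : k ∈ germKernel H a) : g * k * g⁻¹ ∈ germKernel H a := by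
  refine ⟨H.mul_mem (H.mul_mem hg hk.1) (H.inv_mem hg), ?_⟩
  filter_upwards [(tendsto_nhdsGT (hH _ (H.inv_mem hg))).eventually hk.2] with z hz
  rw [RelIso.mul_apply, RelIso.mul_apply, hz, RelIso.apply_inv_self]

theorem germKernel_fixed_smul {H : Subgroup (X ≃o X)} {a q : X} (hH : ∀ g ∈ H, g a = a)
    {g : X ≃o X} (hg : g ∈ H) (hq : ∀ k ∈ germKernel H a, k q = q) :
    ∀ k ∈ germKernel H a, k (g q) = g q := by
  intro k hk
  have := hq _ (germKernel_conj hH (H.inv_mem hg) hk)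
  rw [inv_inv, RelIso.mul_apply, RelIso.mul_apply] at this
  conv_rhs => rw [← this, RelIso.apply_inv_self]

/-! ### Tame groups: first fixed points and the translation at the left end -/

section Tame

variable [DenselyOrdered X]

/-- The start is the infimum of the moved points to the right of a. The germ dichotomy excludes
fixed points of k accumulating at it from the right. -/
theorem exists_start {k : X ≃o X}
    (hk : ∀ a, k a = a → (∀ᶠ z in 𝓝[>] a, k z = z) ∨ ∀ᶠ z in 𝓝[>] a, k z ≠ z) {a y : X}
    (ha : ∀ᶠ z in 𝓝[>] a, k z = z) (hay : a < y) (hy : k y ≠ y) :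
    ∃ s, a < s ∧ s < y ∧ IsStart k s := by
  obtain ⟨e, hae, he⟩ := exists_Ioo_right hay ha
  set S := {z | a < z ∧ k z ≠ z} with hS
  have has : a < sInf S := hae.trans_le (le_sInf fun z hz => by
    by_contra! h
    exact hz.2 (he z ⟨hz.1, h⟩))
  have hlt : ∀ z ∈ Ioo a (sInf S), k z = z := fun z hz => by
    by_contra h
    exact absurd hz.2 (not_lt.2 (sInf_le ⟨hz.1, h⟩))
  have hfix : k (sInf S) = sInf S := fixed_right has hlt
  have hle : sInf S ≤ y := sInf_le ⟨hay, hy⟩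
  have hlt' : sInf S < y := lt_of_le_of_ne hle fun h => hy (by rw [← h]; exact hfix)
  refine ⟨sInf S, has, hlt', bot_le.trans_lt has, ?_, (hk _ hfix).resolve_left fun h => ?_⟩
  · filter_upwards [Ioo_mem_nhdsLT has] with z hz using hlt z hz
  · obtain ⟨e', he', h'⟩ := exists_Ioo_right hlt' h
    refine absurd he' (not_lt.2 (le_sInf fun z hz => ?_))
    by_contra! hze
    rcases (sInf_le hz : sInf S ≤ z).eq_or_lt with h0 | h0
    · exact hz.2 (by rw [← h0]; exact hfix)
    · exact hz.2 (h' z ⟨h0, hze⟩)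

/-- Otherwise each generator would be trivial just right of a, hence, there being finitely many, all
on one common neighborhood, whose points the whole group would fix. -/
theorem IsComponent.exists_moves {H : Subgroup (X ≃o X)} {a d : X} (hc : IsComponent H a d)
    {G : Subgroup (X ≃o X)} (hG : IsTame G) (hHG : H ≤ G) (hfg : H.FG) :
    ∃ h ∈ H, ∀ᶠ z in 𝓝[>] a, h z ≠ z := by
  by_contra! hcon
  obtain ⟨F, hF, hfin⟩ := (Subgroup.fg_iff H).1 hfg
  have hev : ∀ᶠ z in 𝓝[>] a, ∀ f ∈ F, f z = z := by
    refine (eventually_all_finite hfin).2 fun f hf => ?_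
    have hfH : f ∈ H := by rw [← hF]; exact Subgroup.subset_closure hf
    exact (hG.right_dichotomy f (hHG hfH) a (hc.left_fixed f hfH)).resolve_right
      (hcon f hfH)
  have : (𝓝[>] a).NeBot := nhdsGT_neBot_of_exists_gt ⟨d, hc.lt⟩
  obtain ⟨z, hz, hzd⟩ := (hev.and (Ioo_mem_nhdsGT hc.lt)).exists
  obtain ⟨g, hg, hgz⟩ := hc.moved z hzd
  refine hgz ?_
  rw [← hF] at hg
  have : Subgroup.closure F ≤ MulAction.stabilizer (X ≃o X) z :=
    (Subgroup.closure_le _).2 fun f hf => hz f hf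
  exact this hg

/-- This is where the absence of chains enters: q is the first fixed point of f after a, and an
element of the kernel moving q would start at some s in (a, q), while f moves all of [s, q). -/
theorem IsComponent.exists_germKernel_fixed {H : Subgroup (X ≃o X)} {a d : X}
    (hc : IsComponent H a d) {G : Subgroup (X ≃o X)} (hG : IsTame G) (hHG : H ≤ G) {f : X ≃o X}
    (hf : f ∈ H) (hfa : ∀ᶠ z in 𝓝[>] a, f z ≠ z) {q₀ : X} (hq₀ : q₀ ∈ Ioo a d)
    (hfq : f q₀ = q₀) :
    ∃ q ∈ Ioo a d, f q = q ∧ ∀ k ∈ germKernel H a, k q = q := by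
  obtain ⟨e, hae, he⟩ := exists_Ioo_right hc.lt hfa
  set S := {z | a < z ∧ f z = z} with hS
  have hfix : f (sInf S) = sInf S := sInf_fixed fun z hz => hz.2
  have has : a < sInf S := hae.trans_le (le_sInf fun z hz => by
    by_contra! h
    exact he z ⟨hz.1, h⟩ hz.2)
  have hmove : ∀ z ∈ Ioo a (sInf S), f z ≠ z := fun z hz h =>
    not_lt.2 (sInf_le (show z ∈ S from ⟨hz.1, h⟩)) hz.2
  refine ⟨sInf S, ⟨has, (sInf_le (show q₀ ∈ S from ⟨hq₀.1, hfq⟩)).trans_lt hq₀.2⟩, hfix, fun k hk => ?_⟩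
  by_contra hkq
  obtain ⟨s, has', hsq, hs⟩ := exists_start (hG.right_dichotomy k (hHG hk.1)) hk.2 has hkq
  exact hkq (hG.not_chain f (hHG hf) k (hHG hk.1) s _ hsq hs
    (fun z hz => hmove z ⟨has'.trans_le hz.1, hz.2⟩) hfix)

/-- The translation is a generator of the germs at a, or its inverse. A fixed point of it inside
would give one shared with the germ kernel, hence with all of H, contrary to the definition of a
component. -/
theorem IsComponent.exists_translation {H : Subgroup (X ≃o X)} {a d : X}
    (hc : IsComponent H a d) {G : Subgroup (X ≃o X)} (hG : IsTame G) (hHG : H ≤ G)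
    (hfg : H.FG) :
    ∃ h ∈ H, (∀ x ∈ Ioo a d, x < h x) ∧ ∀ g ∈ H, ∃ n : ℤ, ∃ k ∈ germKernel H a, g = h ^ n * k := by
  obtain ⟨h, hh, hgen⟩ := hG.right_cyclic H hHG a hc.left_fixed
  have hdec : ∀ g ∈ H, ∃ n : ℤ, ∃ k ∈ germKernel H a, g = h ^ n * k := by
    intro g hg
    obtain ⟨n, hn⟩ := hgen g hg
    refine ⟨n, (h ^ n)⁻¹ * g, ⟨H.mul_mem (H.inv_mem (H.zpow_mem hh n)) hg, ?_⟩, by group⟩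
    filter_upwards [hn] with z hz
    rw [RelIso.mul_apply, hz, RelIso.inv_apply_self]
  have hmov : ∀ᶠ z in 𝓝[>] a, h z ≠ z := by
    refine (hG.right_dichotomy h (hHG hh) a (hc.left_fixed h hh)).resolve_left fun h0 => ?_
    obtain ⟨g, hg, hga⟩ := hc.exists_moves hG hHG hfg
    obtain ⟨n, k, hk, rfl⟩ := hdec g hg
    have h1 : h ^ n * k ∈ germKernel H a :=
      mul_mem (zpow_mem (show h ∈ germKernel H a from ⟨hh, h0⟩) n) hk
    have : (𝓝[>] a).NeBot := nhdsGT_neBot_of_exists_gt ⟨d, hc.lt⟩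
    obtain ⟨z, hz, hz'⟩ := (hga.and h1.2).exists
    exact hz hz'
  have hno : ∀ x ∈ Ioo a d, h x ≠ x := by
    intro x hx hxx
    obtain ⟨q, hq, hhq, hkq⟩ := hc.exists_germKernel_fixed hG hHG hh hmov hx hxx
    obtain ⟨g, hg, hgq⟩ := hc.moved q hq
    obtain ⟨n, k, hk, rfl⟩ := hdec g hg
    exact hgq (by rw [RelIso.mul_apply, hkq k hk, zpow_fixed hhq])
  rcases moves_same_direction hno with hpos | hneg
  · exact ⟨h, hh, hpos, hdec⟩
  · refine ⟨h⁻¹, H.inv_mem hh, fun x hx => ?_, fun g hg => ?_⟩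
    · have hh' := H.inv_mem hh
      have := hneg _ (mem_Ioo_of_fixed (hc.left_fixed _ hh') (hc.right_fixed _ hh') hx)
      rwa [RelIso.apply_inv_self] at this
    · obtain ⟨n, k, hk, rfl⟩ := hdec g hg
      exact ⟨-n, k, hk, by simp⟩

end Tame

/-! ### Derived series in the ambient group, and comparison of groups on an interval -/

section Derived

variable {A : Type*} [Group A]

/-- The derived series of a subgroup, inside the ambient group. -/
def derived (H : Subgroup A) : ℕ → Subgroup A
  | 0 => H
  | n + 1 => ⁅derived H n, derived H n⁆

theorem derived_le (H : Subgroup A) (n : ℕ) : derived H n ≤ H := by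
  induction n with
  | zero => exact le_rfl
  | succ n ih => exact (Subgroup.commutator_mono ih ih).trans (Subgroup.commutator_le_self H)

theorem derived_succ_le {H K : Subgroup A} (h : ⁅H, H⁆ ≤ K) (n : ℕ) :
    derived H (n + 1) ≤ derived K n := by
  induction n with
  | zero => exact h
  | succ n ih => exact Subgroup.commutator_mono ih ih

theorem map_derivedSeries (H : Subgroup A) (n : ℕ) :
    (derivedSeries H n).map H.subtype = derived H n := by
  induction n with
  | zero => rw [derivedSeries_zero, ← MonoidHom.range_eq_map, Subgroup.range_subtype]; rfl
  | succ n ih => rw [derivedSeries_succ, Subgroup.map_commutator, ih]; rfl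

end Derived

section Agreement

variable {X : Type*} [CompleteLinearOrder X] {v w : X}

/-- `f` and `f'` fix `v` and `w` and agree on `[v, w]`. -/
structure AgreeOn (v w : X) (f f' : X ≃o X) : Prop where
  left : f v = v
  right : f w = w
  left' : f' v = v
  right' : f' w = w
  eq : ∀ z ∈ Icc v w, f z = f' z

theorem AgreeOn.mul {f f' g g' : X ≃o X} (hf : AgreeOn v w f f') (hg : AgreeOn v w g g') :
    AgreeOn v w (f * g) (f' * g') where
  left := by rw [RelIso.mul_apply, hg.left, hf.left]
  right := by rw [RelIso.mul_apply, hg.right, hf.right]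
  left' := by rw [RelIso.mul_apply, hg.left', hf.left']
  right' := by rw [RelIso.mul_apply, hg.right', hf.right']
  eq z hz := by
    rw [RelIso.mul_apply, RelIso.mul_apply, hg.eq z hz,
      hf.eq _ (mem_Icc_of_fixed hg.left' hg.right' hz)]

theorem AgreeOn.inv {f f' : X ≃o X} (hf : AgreeOn v w f f') : AgreeOn v w f⁻¹ f'⁻¹ where
  left := (inv_apply_eq_self_iff _ _).2 hf.left
  right := (inv_apply_eq_self_iff _ _).2 hf.right
  left' := (inv_apply_eq_self_iff _ _).2 hf.left'
  right' := (inv_apply_eq_self_iff _ _).2 hf.right'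
  eq z hz := by
    have := hf.eq _ (mem_Icc_of_fixed ((inv_apply_eq_self_iff _ _).2 hf.left')
      ((inv_apply_eq_self_iff _ _).2 hf.right') hz)
    rw [RelIso.apply_inv_self] at this
    rw [← this, RelIso.inv_apply_self, this]

/-- The automorphisms that agree on `[v, w]` with an element of `L`, where `v` and `w` are fixed. -/
def agreeing (v w : X) (L : Subgroup (X ≃o X)) : Subgroup (X ≃o X) where
  carrier := {k | ∃ l ∈ L, AgreeOn v w k l}
  one_mem' := ⟨1, L.one_mem, rfl, rfl, rfl, rfl, fun _ _ => rfl⟩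
  mul_mem' := by
    rintro f g ⟨f', hf', hf⟩ ⟨g', hg', hg⟩
    exact ⟨f' * g', L.mul_mem hf' hg', hf.mul hg⟩
  inv_mem' := by
    rintro f ⟨f', hf', hf⟩
    exact ⟨f'⁻¹, L.inv_mem hf', hf.inv⟩

theorem derived_le_agreeing {K L : Subgroup (X ≃o X)} (h : K ≤ agreeing v w L) (n : ℕ) :
    derived K n ≤ agreeing v w (derived L n) := by
  induction n with
  | zero => exact h
  | succ n ih =>
    refine (Subgroup.commutator_mono ih ih).trans (Subgroup.commutator_le.2 ?_)
    rintro f ⟨f', hf', hf⟩ g ⟨g', hg', hg⟩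
    exact ⟨f' * g' * f'⁻¹ * g'⁻¹, Subgroup.commutator_mem_commutator hf' hg',
      ((hf.mul hg).mul hf.inv).mul hg.inv⟩

theorem IsComponent.of_agreeing {K L : Subgroup (X ≃o X)} {v w : X} (hvw : IsComponent K v w)
    (hLK : L ≤ K) (hKL : K ≤ agreeing v w L) : IsComponent L v w where
  lt := hvw.lt
  left_fixed g hg := hvw.left_fixed g (hLK hg)
  right_fixed g hg := hvw.right_fixed g (hLK hg)
  moved x hx := by
    obtain ⟨k, hk, hkx⟩ := hvw.moved x hx
    obtain ⟨l, hl, hkl⟩ := hKL hk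
    exact ⟨l, hl, by rwa [← hkl.eq x ⟨hx.1.le, hx.2.le⟩]⟩

end Agreement

section Translation

variable {X : Type*} [CompleteLinearOrder X]

/-- Every element of a group generated by `h` and a set `C` is the product of an element of the
group generated by the conjugates of `C` under powers of `h` and of a power of `h`. -/
theorem exists_conj_mul_zpow {A : Type*} [Group A] (h : A) (C : Set A) {g : A}
    (hg : g ∈ Subgroup.closure (insert h C)) :
    ∃ ν ∈ Subgroup.closure {x | ∃ c ∈ C, ∃ i : ℤ, x = h ^ i * c * (h ^ i)⁻¹}, ∃ m : ℤ,
      g = ν * h ^ m := by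
  set N := Subgroup.closure {x | ∃ c ∈ C, ∃ i : ℤ, x = h ^ i * c * (h ^ i)⁻¹} with hN
  have hconj : ∀ m : ℤ, ∀ ν ∈ N, h ^ m * ν * (h ^ m)⁻¹ ∈ N := by
    intro m ν hν
    have : N ≤ N.comap (MulAut.conj (h ^ m)).toMonoidHom := by
      refine (Subgroup.closure_le _).2 ?_
      rintro _ ⟨c, hc, i, rfl⟩
      refine Subgroup.subset_closure ⟨c, hc, m + i, ?_⟩
      simp only [MulEquiv.coe_toMonoidHom, MulAut.conj_apply, _root_.zpow_add]
      group
    exact this hν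
  induction hg using Subgroup.closure_induction with
  | mem x hx =>
    rcases hx with rfl | hx
    · exact ⟨1, N.one_mem, 1, by simp⟩
    · exact ⟨x, Subgroup.subset_closure ⟨x, hx, 0, by simp⟩, 0, by simp⟩
  | one => exact ⟨1, N.one_mem, 0, by simp⟩
  | mul x y _ _ hx hy =>
    obtain ⟨ν, hν, m, rfl⟩ := hx
    obtain ⟨ν', hν', m', rfl⟩ := hy
    exact ⟨ν * (h ^ m * ν' * (h ^ m)⁻¹), N.mul_mem hν (hconj m ν' hν'), m + m', by group⟩
  | inv x _ hx =>
    obtain ⟨ν, hν, m, rfl⟩ := hx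
    exact ⟨h ^ (-m) * ν⁻¹ * (h ^ (-m))⁻¹, hconj (-m) _ (N.inv_mem hν), -m, by group⟩

end Translation

theorem pow_apply_le_pow_apply {X : Type*} [CompleteLinearOrder X] {h : X ≃o X} {a d x : X}
    (hh : ∀ x ∈ Ioo a d, x < h x) (ha : h a = a) (hd : h d = d) (hx : x ∈ Ioo a d) {m n : ℕ}
    (hmn : m ≤ n) : (h ^ m) x ≤ (h ^ n) x := by
  obtain ⟨l, rfl⟩ := Nat.exists_eq_add_of_le hmn
  rw [pow_add, RelIso.mul_apply]
  refine (h ^ m).monotone ?_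
  rcases eq_or_ne l 0 with rfl | hl
  · exact le_rfl
  · exact (lt_pow_apply hh ha hd hx hl).le

/-! ### The germ kernel: triviality at the right end, fixed points, finite generation -/

section Kernel

variable {X : Type*} [CompleteLinearOrder X] [TopologicalSpace X] [OrderTopology X]
  [DenselyOrdered X] {G H : Subgroup (X ≃o X)} {a d : X}

/-- Near the right end of a component, an element of the kernel of germs at the left end is the
identity. -/
theorem IsComponent.germKernel_trivial_right (hc : IsComponent H a d) (hG : IsTame G)
    (hHG : H ≤ G) (hfg : H.FG) {k : X ≃o X} (hk : k ∈ germKernel H a) :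
    ∀ᶠ z in 𝓝[<] d, k z = z := by
  obtain ⟨h, hh, hpos, -⟩ := hc.exists_translation hG hHG hfg
  have hha := hc.left_fixed h hh
  have hhd := hc.right_fixed h hh
  refine (hG.left_dichotomy k (hHG hk.1) d (hc.right_fixed k hk.1)).resolve_right fun hkd => ?_
  have : (𝓝[>] a).NeBot := nhdsGT_neBot_of_exists_gt ⟨d, hc.lt⟩
  have : (𝓝[<] d).NeBot := nhdsLT_neBot_of_exists_lt ⟨a, hc.lt⟩
  obtain ⟨γ, hγ, hgen⟩ := hG.left_cyclic H hHG d hc.right_fixed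
  obtain ⟨i, hi⟩ := hgen h hh
  obtain ⟨j, hj⟩ := hgen k hk.1
  have htend : ∀ g ∈ H, Tendsto g (𝓝[<] d) (𝓝[<] d) := fun g hg =>
    tendsto_nhdsLT (hc.right_fixed g hg)
  have hj0 : j ≠ 0 := by
    rintro rfl
    obtain ⟨z, h1, h2⟩ := (hj.and hkd).exists
    exact h2 (by simpa using h1)
  have hhj := eventually_zpow (htend _ (H.zpow_mem hγ i))
    (htend _ (H.inv_mem (H.zpow_mem hγ i))) hi j
  have hki := eventually_zpow (htend _ (H.zpow_mem hγ j))
    (htend _ (H.inv_mem (H.zpow_mem hγ j))) hj i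
  have hki_mem : k ^ i ∈ germKernel H a := zpow_mem hk i
  -- Near d, h and k agree with the i-th and j-th powers of the generator γ, so both h ^ j and k ^ i
  -- agree with γ ^ (i * j). Thus f is trivial near d, but near a it agrees with h ^ j, which has no
  -- fixed point.
  set f := (k ^ i)⁻¹ * h ^ j with hf
  have hfH : f ∈ H := H.mul_mem (H.inv_mem hki_mem.1) (H.zpow_mem hh j)
  have hf_iff : ∀ z, f z = z ↔ (h ^ j) z = (k ^ i) z := by
    intro z
    rw [hf, RelIso.mul_apply]
    constructor
    · intro h0; rw [← RelIso.apply_inv_self (k ^ i) ((h ^ j) z), h0]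
    · intro h0; rw [h0, RelIso.inv_apply_self]
  have hfd : ∀ᶠ z in 𝓝[<] d, f z = z := by
    filter_upwards [hhj, hki] with z h1 h2
    rw [hf_iff, h1, h2, ← _root_.zpow_mul, ← _root_.zpow_mul, mul_comm]
  have hfa : ∀ᶠ z in 𝓝[>] a, f z ≠ z := by
    filter_upwards [hki_mem.2, Ioo_mem_nhdsGT hc.lt] with z h1 h2
    rw [Ne, hf_iff, h1]
    exact zpow_apply_ne hpos hha hhd h2 hj0
  obtain ⟨q₀, hq₀, hq₀'⟩ := (hfd.and (Ioo_mem_nhdsLT hc.lt)).exists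
  obtain ⟨q, hq, -, hkq⟩ := hc.exists_germKernel_fixed hG hHG hfH hfa hq₀' hq₀
  obtain ⟨e, hed, he⟩ := exists_Ioo_left hc.lt hkd
  -- The translates of q by powers of h are also fixed by the normal subgroup `germKernel H a`, and
  -- they accumulate at d, where k was supposed to move every point.
  obtain ⟨n, hn⟩ := exists_lt_pow hpos hq hed
  have hn' := H.pow_mem hh n
  exact he _ ⟨hn, (mem_Ioo_of_fixed (hc.left_fixed _ hn') (hc.right_fixed _ hn') hq).2⟩
    (germKernel_fixed_smul hc.left_fixed hn' hkq k hk)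

/-- The kernel of germs at the left end of a component has a fixed point inside it. -/
theorem IsComponent.exists_fixed (hc : IsComponent H a d) (hG : IsTame G)
    (hHG : H ≤ G) (hfg : H.FG) : ∃ q ∈ Ioo a d, ∀ k ∈ germKernel H a, k q = q := by
  obtain ⟨h, hh, hpos, -⟩ := hc.exists_translation hG hHG hfg
  by_contra! hno
  obtain ⟨x, hx⟩ := exists_between hc.lt
  -- If the kernel could not push x beyond h x, the supremum of the orbit of x would be a fixed
  -- point of the kernel inside (a, d).
  have hsup : h x < ⨆ k : germKernel H a, k.1 x := by
    by_contra! hle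
    have hx' : x ≤ ⨆ k : germKernel H a, k.1 x :=
      le_iSup (fun k : germKernel H a => k.1 x) 1
    obtain ⟨k, hk, hkm⟩ := hno _ ⟨hx.1.trans_le hx', hle.trans_lt
      (mem_Ioo_of_fixed (hc.left_fixed h hh) (hc.right_fixed h hh) hx).2⟩
    refine hkm ?_
    rw [OrderIso.map_iSup]
    exact (Equiv.mulLeft (⟨k, hk⟩ : germKernel H a)).iSup_congr fun l => rfl
  obtain ⟨⟨k, hk⟩, hkx⟩ := lt_iSup_iff.1 hsup
  -- This element moves points up near a, like h, but moves x down; so it has a fixed point between,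
  -- and its first fixed point is fixed by the kernel.
  have hf : k⁻¹ * h ∈ H := H.mul_mem (H.inv_mem hk.1) hh
  have hup : ∀ᶠ z in 𝓝[>] a, z < (k⁻¹ * h) z := by
    filter_upwards [(tendsto_nhdsGT (hc.left_fixed h hh)).eventually (inv_mem hk).2,
      Ioo_mem_nhdsGT hc.lt] with z h1 h2
    rw [RelIso.mul_apply, h1]
    exact hpos z h2
  have hdown : (k⁻¹ * h) x < x := by
    have := (k⁻¹).strictMono hkx
    rwa [RelIso.inv_apply_self] at this
  have : (𝓝[>] a).NeBot := nhdsGT_neBot_of_exists_gt ⟨d, hc.lt⟩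
  obtain ⟨y, hy, hy'⟩ := (hup.and (Ioo_mem_nhdsGT hc.lt)).exists
  obtain ⟨q₀, hq₀, hq₀'⟩ := (isPreconnected_Ioo (a := a) (b := d)).intermediate_value₂ hx hy'
    (k⁻¹ * h).continuous.continuousOn continuousOn_id hdown.le hy.le
  obtain ⟨q, hq, -, hkq⟩ := hc.exists_germKernel_fixed hG hHG hf
    (hup.mono fun z hz => hz.ne') hq₀ hq₀'
  obtain ⟨k', hk', hne⟩ := hno q hq
  exact hne (hkq k' hk')

/-- Between two of its fixed points inside a component, the kernel of germs at the left end acts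
through a finitely generated group. -/
theorem IsComponent.exists_fg_agreeing (hc : IsComponent H a d) (hG : IsTame G)
    (hHG : H ≤ G) (hfg : H.FG) {p r : X} (hp : p ∈ Ioo a d) (hr : r ∈ Ioo a d)
    (hKp : ∀ k ∈ germKernel H a, k p = p) (hKr : ∀ k ∈ germKernel H a, k r = r) :
    ∃ L ≤ germKernel H a, L.FG ∧ germKernel H a ≤ agreeing p r L := by
  obtain ⟨h, hh, hpos, hdec⟩ := hc.exists_translation hG hHG hfg
  have hha := hc.left_fixed h hh
  have hhd := hc.right_fixed h hh
  obtain ⟨F, hF, hfin⟩ := (Subgroup.fg_iff H).1 hfg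
  have hFH : ∀ f ∈ F, f ∈ H := fun f hf => by rw [← hF]; exact Subgroup.subset_closure hf
  choose! n κ hκ hnκ using hdec
  set C := κ '' F with hC
  have hCK : ∀ c ∈ C, c ∈ germKernel H a := by
    rintro _ ⟨f, hf, rfl⟩; exact hκ f (hFH f hf)
  have hHC : H ≤ Subgroup.closure (insert h C) := by
    rw [← hF]
    refine (Subgroup.closure_le _).2 fun f hf => ?_
    rw [SetLike.mem_coe, hnκ f (hFH f hf)]
    exact mul_mem (zpow_mem (Subgroup.subset_closure (mem_insert _ _)) _)
      (Subgroup.subset_closure (mem_insert_of_mem _ (mem_image_of_mem _ hf)))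
  have hconjK : ∀ c ∈ C, ∀ i : ℤ, h ^ i * c * (h ^ i)⁻¹ ∈ germKernel H a := fun c hcC i =>
    germKernel_conj hc.left_fixed (H.zpow_mem hh i) (hCK c hcC)
  -- Inside (a, d) each c is supported away from both ends, so for large |i| the translation h ^ i
  -- carries its support off [p, r].
  have hbound : ∀ c ∈ C, ∃ N : ℕ, ∀ i : ℤ, (N : ℤ) < |i| → ∀ z ∈ Icc p r,
      (h ^ i * c * (h ^ i)⁻¹) z = z := by
    intro c hcC
    obtain ⟨u, hau, hu⟩ := exists_Ioo_right hc.lt (hCK c hcC).2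
    obtain ⟨v, hvd, hv⟩ := exists_Ioo_left hc.lt
      (hc.germKernel_trivial_right hG hHG hfg (hCK c hcC))
    obtain ⟨u₀, hu₀, hu₀'⟩ := exists_between (lt_min hau hc.lt)
    have hu₀d : u₀ ∈ Ioo a d := ⟨hu₀, hu₀'.trans_le (min_le_right _ _)⟩
    obtain ⟨N₁, hN₁⟩ := exists_lt_pow hpos hu₀d hr.2
    obtain ⟨N₂, hN₂⟩ := exists_lt_pow hpos hp hvd
    refine ⟨max N₁ N₂, fun i hi z hz => ?_⟩
    have hzd : z ∈ Ioo a d := ⟨hp.1.trans_le hz.1, hz.2.trans_lt hr.2⟩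
    have hpow : ∀ g ∈ H, g z ∈ Ioo a d := fun g hg =>
      mem_Ioo_of_fixed (hc.left_fixed g hg) (hc.right_fixed g hg) hzd
    suffices hcz : c ((h ^ i)⁻¹ z) = (h ^ i)⁻¹ z by
      rw [RelIso.mul_apply, RelIso.mul_apply, hcz, RelIso.apply_inv_self]
    have hmem := hpow _ (H.inv_mem (H.zpow_mem hh i))
    obtain ⟨j, rfl | rfl⟩ := i.eq_nat_or_neg
    · rw [abs_of_nonneg (by positivity), Nat.cast_lt] at hi
      have h1 : z < (h ^ (j : ℤ)) u₀ := by
        rw [zpow_natCast]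
        exact (hz.2.trans_lt hN₁).trans_le (pow_apply_le_pow_apply hpos hha hhd hu₀d
          ((le_max_left _ _).trans hi.le))
      have h2 := (h ^ (j : ℤ))⁻¹.strictMono h1
      rw [RelIso.inv_apply_self] at h2
      exact hu _ ⟨hmem.1, h2.trans (hu₀'.trans_le (min_le_left _ _))⟩
    · rw [abs_neg, abs_of_nonneg (by positivity), Nat.cast_lt] at hi
      rw [_root_.zpow_neg, inv_inv, zpow_natCast] at hmem ⊢
      refine hv _ ⟨hN₂.trans_le ?_, hmem.2⟩
      exact (pow_apply_le_pow_apply hpos hha hhd hp ((le_max_right _ _).trans hi.le)).trans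
        ((h ^ j).monotone hz.1)
  choose! N hN using hbound
  refine ⟨Subgroup.closure (⋃ c ∈ C, (fun i : ℤ => h ^ i * c * (h ^ i)⁻¹) ''
    Icc (-(N c : ℤ)) (N c)), (Subgroup.closure_le _).2 ?_, ?_, fun k hk => ?_⟩
  · simp only [iUnion_subset_iff, image_subset_iff]
    intro c hcC i _
    exact hconjK c hcC i
  · exact (Subgroup.fg_iff _).2 ⟨_, rfl, (hfin.image κ).biUnion fun c _ => (finite_Icc _ _).image _⟩
  · obtain ⟨ν, hν, m, rfl⟩ := exists_conj_mul_zpow h C (hHC hk.1)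
    have hνK : ν ∈ germKernel H a := by
      refine (Subgroup.closure_le _).2 ?_ hν
      rintro _ ⟨c, hcC, i, rfl⟩
      exact hconjK c hcC i
    -- A nonzero power of h moves every point just right of a, so it is not in the kernel.
    have hm : m = 0 := by
      by_contra hm
      have h1 : h ^ m ∈ germKernel H a := (Subgroup.mul_mem_cancel_left _ hνK).1 hk
      have : (𝓝[>] a).NeBot := nhdsGT_neBot_of_exists_gt ⟨d, hc.lt⟩
      obtain ⟨z, hz, hz'⟩ := (h1.2.and (Ioo_mem_nhdsGT hc.lt)).exists
      exact zpow_apply_ne hpos hha hhd hz' hm hz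
    rw [hm, zpow_zero, mul_one]
    refine (Subgroup.closure_le _).2 ?_ hν
    rintro _ ⟨c, hcC, i, rfl⟩
    have hfp := hKp _ (hconjK c hcC i)
    have hfr := hKr _ (hconjK c hcC i)
    by_cases hi : |i| ≤ N c
    · exact ⟨_, Subgroup.subset_closure (mem_biUnion hcC ⟨i, abs_le.1 hi, rfl⟩),
        hfp, hfr, hfp, hfr, fun _ _ => rfl⟩
    · exact ⟨1, one_mem _, hfp, hfr, rfl, rfl, hN c hcC i (not_le.1 hi)⟩

end Kernel

/-! ### Induction on the number of orbits of starts -/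

section Solvable

variable {X : Type*} [CompleteLinearOrder X] [TopologicalSpace X] [OrderTopology X]
  [DenselyOrdered X] {G H : Subgroup (X ≃o X)} {a d : X}

/-- The components of the kernel of germs at the left end of a component are relatively compact. -/
theorem IsComponent.germKernel_component_mem (hc : IsComponent H a d) (hG : IsTame G)
    (hHG : H ≤ G) (hfg : H.FG) {v w x : X} (hvw : IsComponent (germKernel H a) v w)
    (hx : x ∈ Ioo v w) (hxa : x ∈ Ioo a d) : v ∈ Ioo a d ∧ w ∈ Ioo a d := by
  obtain ⟨h, hh, hpos, -⟩ := hc.exists_translation hG hHG hfg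
  obtain ⟨q, hq, hKq⟩ := hc.exists_fixed hG hHG hfg
  have hout : ∀ g ∈ H, g q ∉ Ioo v w := fun g hg hmem => by
    obtain ⟨k, hk, hne⟩ := hvw.moved _ hmem
    exact hne (germKernel_fixed_smul hc.left_fixed hg hKq k hk)
  have hin : ∀ g ∈ H, g q ∈ Ioo a d := fun g hg =>
    mem_Ioo_of_fixed (hc.left_fixed g hg) (hc.right_fixed g hg) hq
  obtain ⟨n, hn⟩ := exists_lt_pow hpos hq hxa.2
  obtain ⟨m, hm⟩ := exists_lt_pow hpos hxa hq.2
  have hnH := H.pow_mem hh n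
  have hmH := H.inv_mem (H.pow_mem hh m)
  have hm' : (h ^ m)⁻¹ q < x := by
    have := (h ^ m)⁻¹.strictMono hm
    rwa [RelIso.inv_apply_self] at this
  have h1 : w ≤ (h ^ n) q := by
    by_contra! hlt
    exact hout _ hnH ⟨hx.1.trans hn, hlt⟩
  have h2 : (h ^ m)⁻¹ q ≤ v := by
    by_contra! hlt
    exact hout _ hmH ⟨hlt, hm'.trans hx.2⟩
  exact ⟨⟨(hin _ hmH).1.trans_le h2, hx.1.trans hxa.2⟩,
    hxa.1.trans hx.2, h1.trans_lt (hin _ hnH).2⟩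

/-- If the kernel of germs at the left end of a component is not trivial there, then it fixes the
start of one of its elements. -/
theorem IsComponent.exists_fixed_start (hc : IsComponent H a d) (hG : IsTame G)
    (hHG : H ≤ G) (hfg : H.FG) {x : X} (hx : x ∈ Ioo a d) (hxK : ∃ k ∈ germKernel H a, k x ≠ x) :
    ∃ u ∈ Ioo a d, (∀ k ∈ germKernel H a, k u = u) ∧ ∃ k ∈ germKernel H a, IsStart k u := by
  set K := germKernel H a with hK
  have hKG : K ≤ G := fun k hk => hHG hk.1
  have main : ∀ v w y, IsComponent K v w → y ∈ Ioo v w → y ∈ Ioo a d →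
      ∃ L ≤ K, L.FG ∧ K ≤ agreeing v w L ∧ IsComponent L v w := by
    intro v w y hvw hy hya
    obtain ⟨hv, hw⟩ := hc.germKernel_component_mem hG hHG hfg hvw hy hya
    obtain ⟨L, hLK, hLfg, hKL⟩ := hc.exists_fg_agreeing hG hHG hfg hv hw hvw.left_fixed
      hvw.right_fixed
    exact ⟨L, hLK, hLfg, hKL, hvw.of_agreeing hLK hKL⟩
  obtain ⟨v, w, hvw, hxvw⟩ := exists_isComponent hxK
  obtain ⟨hv, hw⟩ := hc.germKernel_component_mem hG hHG hfg hvw hxvw hx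
  obtain ⟨L, hLK, hLfg, hKL, hL⟩ := main v w x hvw hxvw hx
  obtain ⟨k, hkL, hkv⟩ := hL.exists_moves hG (hLK.trans hKG) hLfg
  have hk : k ∈ K := hLK hkL
  -- For this one k, the leftmost point of W will be the start. It stays away from a because k is
  -- trivial there, and it belongs to W by the dichotomy on its right.
  set W := {y | a < y ∧ (∀ k ∈ K, k y = y) ∧ ∀ᶠ z in 𝓝[>] y, k z ≠ z} with hW
  have hvW : v ∈ W := ⟨hv.1, hvw.left_fixed, hkv⟩
  have hle : sInf W ≤ v := sInf_le hvW
  have hfix : ∀ k ∈ K, k (sInf W) = sInf W := fun k hk => sInf_fixed fun z hz => hz.2.1 k hk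
  have hlt : a < sInf W := by
    obtain ⟨e, hae, he⟩ := exists_Ioo_right hc.lt hk.2
    refine hae.trans_le (le_sInf fun y hy => ?_)
    by_contra! hye
    have : (𝓝[>] y).NeBot := nhdsGT_neBot_of_exists_gt ⟨e, hye⟩
    obtain ⟨z, hz, hz'⟩ := (hy.2.2.and (Ioo_mem_nhdsGT hye)).exists
    exact hz (he z ⟨hy.1.trans hz'.1, hz'.2⟩)
  have hu : sInf W ∈ Ioo a d := ⟨hlt, hle.trans_lt hv.2⟩
  have hright : ∀ᶠ z in 𝓝[>] (sInf W), k z ≠ z := by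
    refine (hG.right_dichotomy k (hKG hk) _ (hfix k hk)).resolve_left fun h0 => ?_
    obtain ⟨e, hae, he⟩ := exists_Ioo_right hu.2 h0
    refine absurd hae (not_lt.2 (le_sInf fun y hy => ?_))
    by_contra! hye
    have : (𝓝[>] y).NeBot := nhdsGT_neBot_of_exists_gt ⟨e, hye⟩
    obtain ⟨z, hz, hz'⟩ := (hy.2.2.and (Ioo_mem_nhdsGT hye)).exists
    exact hz (he z ⟨(sInf_le hy : sInf W ≤ y).trans_lt hz'.1, hz'.2⟩)
  refine ⟨sInf W, hu, hfix, k, hk, bot_le.trans_lt hlt,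
    (hG.left_dichotomy k (hKG hk) _ (hfix k hk)).resolve_right fun h0 => ?_, hright⟩
  -- If k moved the points just left of `sInf W`, a component (v', w') of K would end there. An
  -- element l of the finitely generated group acting on it agrees with k; being nontrivial near w',
  -- it is nontrivial near v' too. So v' is a smaller point of W.
  obtain ⟨e, heu, he⟩ := exists_Ioo_left hlt h0
  obtain ⟨y, hy, hyu⟩ := exists_between (max_lt heu hlt)
  have hye := (le_max_left _ _).trans_lt hy
  have hya := (le_max_right _ _).trans_lt hy
  obtain ⟨v', w', hvw', hy'⟩ := exists_isComponent ⟨k, hk, he y ⟨hye, hyu⟩⟩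
  have hw'u : w' = sInf W := by
    refine le_antisymm ?_ ?_
    · by_contra! hlt'
      obtain ⟨l, hl, hne⟩ := hvw'.moved _ ⟨hy'.1.trans hyu, hlt'⟩
      exact hne (hfix l hl)
    · by_contra! hlt'
      exact he w' ⟨hye.trans hy'.2, hlt'⟩ (hvw'.right_fixed k hk)
  have hyd : y ∈ Ioo a d := ⟨hya, hyu.trans hu.2⟩
  obtain ⟨hv', -⟩ := hc.germKernel_component_mem hG hHG hfg hvw' hy' hyd
  obtain ⟨L', hLK', hLfg', hKL', hL'⟩ := main v' w' y hvw' hy' hyd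
  obtain ⟨l, hl, hkl⟩ := hKL' hk
  have hlw : ∀ᶠ z in 𝓝[<] w', l z ≠ z := by
    filter_upwards [Ioo_mem_nhdsLT (hw'u ▸ heu), Ioo_mem_nhdsLT hvw'.lt] with z h1 h2
    rw [← hkl.eq z ⟨h2.1.le, h2.2.le⟩]
    exact he z (hw'u ▸ h1)
  have hlv : ∀ᶠ z in 𝓝[>] v', l z ≠ z := by
    refine (hG.right_dichotomy l (hKG (hLK' hl)) _ hkl.left').resolve_left fun h0 => ?_
    have : (𝓝[<] w').NeBot := nhdsLT_neBot_of_exists_lt ⟨_, hvw'.lt⟩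
    obtain ⟨z, hz, hz'⟩ := (hlw.and (hL'.germKernel_trivial_right hG (hLK'.trans hKG) hLfg'
      ⟨hl, h0⟩)).exists
    exact hz hz'
  have hv'W : v' ∈ W := by
    refine ⟨hv'.1, hvw'.left_fixed, ?_⟩
    filter_upwards [hlv, Ioo_mem_nhdsGT hvw'.lt] with z h1 h2
    rwa [hkl.eq z ⟨h2.1.le, h2.2.le⟩]
  exact absurd (sInf_le hv'W) (not_le.2 (hy'.1.trans hyu))

/-- Modulo the normal subgroup of trivial germs, H is generated by the single translation h. -/
theorem IsComponent.commutator_le (hc : IsComponent H a d) (hG : IsTame G)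
    (hHG : H ≤ G) (hfg : H.FG) : ⁅H, H⁆ ≤ germKernel H a := by
  obtain ⟨h, hh, -, hdec⟩ := hc.exists_translation hG hHG hfg
  refine Subgroup.commutator_le.2 fun f hf g hg => ?_
  obtain ⟨n, k, hk, rfl⟩ := hdec f hf
  obtain ⟨n', k', hk', rfl⟩ := hdec g hg
  have hconj : ∀ (i : ℤ), ∀ k ∈ germKernel H a, h ^ i * k * (h ^ i)⁻¹ ∈ germKernel H a :=
    fun i k hk => germKernel_conj hc.left_fixed (H.zpow_mem hh i) hk
  convert mul_mem (mul_mem (hconj n k hk) (hconj (n + n') _ (mul_mem hk' (inv_mem hk))))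
    (hconj n' _ (inv_mem hk')) using 1
  rw [commutatorElement_def]
  group

/-- A finitely generated tame group whose starts fall, on a component, into less than `n` orbits
acts on that component through a solvable group of derived length at most `n`. -/
theorem derived_trivial (hG : IsTame G) (n : ℕ) : ∀ (H : Subgroup (X ≃o X)) (a d : X),
    H ≤ G → H.FG → IsComponent H a d → ∀ B : Finset X, B.card < n →
    (∀ g ∈ G, ∀ s ∈ Ioo a d, IsStart g s → ∃ b ∈ B, ∃ g ∈ H, s = g b) →
    ∀ g ∈ derived H n, ∀ x ∈ Ioo a d, g x = x := by
  classical
  induction n with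
  | zero => exact fun _ _ _ _ _ _ B hB => absurd hB (Nat.not_lt_zero _)
  | succ m ih =>
    intro H a d hHG hfg hc B hB hstart k hk x hx
    replace hk := derived_succ_le (hc.commutator_le hG hHG hfg) m hk
    by_contra hkx
    obtain ⟨h, hh, hpos, hdec⟩ := hc.exists_translation hG hHG hfg
    obtain ⟨u, hu, hKu, l, hl, hlu⟩ := hc.exists_fixed_start hG hHG hfg hx
      ⟨k, derived_le _ _ hk, hkx⟩
    obtain ⟨v, w, hvw, hxvw⟩ := exists_isComponent ⟨k, derived_le _ _ hk, hkx⟩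
    obtain ⟨hv, hw⟩ := hc.germKernel_component_mem hG hHG hfg hvw hxvw hx
    obtain ⟨L, hLK, hLfg, hKL⟩ := hc.exists_fg_agreeing hG hHG hfg hv hw hvw.left_fixed
      hvw.right_fixed
    have hL := hvw.of_agreeing hLK hKL
    have hout : ∀ g ∈ H, ∀ y, (∀ k ∈ germKernel H a, k y = y) → g y ∉ Ioo v w :=
      fun g hg y hy hmem => by
        obtain ⟨k, hk, hne⟩ := hvw.moved _ hmem
        exact hne (germKernel_fixed_smul hc.left_fixed hg hy k hk)
    -- an element of `H` that maps a point of `(v, w)` into `(v, w)` lies in the kernel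
    have hreturn : ∀ g ∈ H, ∀ y ∈ Ioo v w, g y ∈ Ioo v w → ∃ l ∈ L, g y = l y := by
      intro g hg y hy hgy
      obtain ⟨j, k, hk, rfl⟩ := hdec g hg
      obtain ⟨l, hl, hkl⟩ := hKL hk
      have hky : k y ∈ Ioo v w := mem_Ioo_of_fixed hkl.left hkl.right hy
      have hjH := H.zpow_mem hh j
      -- Translates of v and w are fixed by the kernel, so they cannot lie in (v, w). As h ^ j takes
      -- a point of (v, w) into (v, w), it must fix v; a translation does so only for j = 0.
      have hjv : (h ^ j) v = v := by
        rw [RelIso.mul_apply] at hgy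
        rcases lt_trichotomy ((h ^ j) v) v with hlt | heq | hgt
        · have h1 : v < (h ^ j) w := hgy.1.trans ((h ^ j).strictMono hky.2)
          have h2 : w ≤ (h ^ j) w := by
            by_contra! hlt'
            exact hout _ hjH w hvw.right_fixed ⟨h1, hlt'⟩
          have h3 : (h ^ j)⁻¹ v ∈ Ioo v w := by
            constructor
            · have := (h ^ j)⁻¹.strictMono hlt
              rwa [RelIso.inv_apply_self] at this
            · have := (h ^ j)⁻¹.strictMono h1
              rwa [RelIso.inv_apply_self] at this
          exact absurd h3 (hout _ (H.inv_mem hjH) v hvw.left_fixed)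
        · exact heq
        · exact absurd ⟨hgt, ((h ^ j).strictMono hky.1).trans hgy.2⟩
            (hout _ hjH v hvw.left_fixed)
      have hj0 : j = 0 := by
        by_contra hj
        exact zpow_apply_ne hpos (hc.left_fixed h hh) (hc.right_fixed h hh) hv hj hjv
      subst hj0
      exact ⟨l, hl, by rw [zpow_zero, one_mul, hkl.eq y ⟨hy.1.le, hy.2.le⟩]⟩
    obtain ⟨b₀, hb₀, g₀, hg₀, rfl⟩ := hstart l (hHG hl.1) u hu hlu
    have hrep : ∀ b : X, ∃ b' : X, (∃ g ∈ H, g b ∈ Ioo v w) → b' ∈ Ioo v w ∧ ∃ g ∈ H, b = g b' := by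
      intro b
      by_cases hb : ∃ g ∈ H, g b ∈ Ioo v w
      · obtain ⟨g, hg, hgb⟩ := hb
        exact ⟨g b, fun _ => ⟨hgb, g⁻¹, H.inv_mem hg, (RelIso.inv_apply_self g b).symm⟩⟩
      · exact ⟨b, fun h => absurd h hb⟩
    choose φ hφ using hrep
    obtain ⟨k', hk', hkk'⟩ := derived_le_agreeing hKL m hk
    refine hkx ?_
    rw [hkk'.eq x ⟨hxvw.1.le, hxvw.2.le⟩]
    -- The orbit of b₀ contains the start fixed by the kernel and never enters (v, w). For each
    -- remaining orbit that does, φ picks a representative inside.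
    refine ih L v w (fun l hl => hHG (hLK hl).1) hLfg hL ((B.erase b₀).image φ) ?_ ?_ k' hk' x hxvw
    · refine Finset.card_image_le.trans_lt ?_
      rw [Finset.card_erase_of_mem hb₀]
      have : 0 < B.card := Finset.card_pos.2 ⟨b₀, hb₀⟩
      omega
    · intro g hg s hs hgs
      obtain ⟨b, hb, f, hf, rfl⟩ := hstart g hg s ⟨hv.1.trans hs.1, hs.2.trans hw.2⟩ hgs
      have hbb₀ : b ≠ b₀ := by
        rintro rfl
        refine hout (f * g₀⁻¹) (H.mul_mem hf (H.inv_mem hg₀)) _ hKu ?_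
        rwa [RelIso.mul_apply, RelIso.inv_apply_self]
      obtain ⟨hb', f', hf', hbf'⟩ := hφ b ⟨f, hf, hs⟩
      refine ⟨φ b, Finset.mem_image_of_mem _ (Finset.mem_erase.2 ⟨hbb₀, hb⟩), ?_⟩
      have hs' : f b = (f * f') (φ b) := by rw [RelIso.mul_apply, ← hbf']
      rw [hs'] at hs ⊢
      exact hreturn _ (H.mul_mem hf hf') _ hb' hs

/-- A finitely generated tame group whose starts fall into finitely many orbits is solvable. -/
theorem isSolvable (hG : IsTame G) (hfg : G.FG) (B : Finset X)
    (hstart : ∀ g ∈ G, ∀ s < ⊤, IsStart g s → ∃ b ∈ B, ∃ g ∈ G, s = g b) : Group.IsSolvable G := by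
  refine ⟨B.card + 1, ?_⟩
  refine (Subgroup.map_eq_bot_iff_of_injective _ G.subtype_injective).1 ?_
  rw [map_derivedSeries, eq_bot_iff]
  intro g hg
  rw [Subgroup.mem_bot]
  ext x
  by_contra hgx
  obtain ⟨a, d, hc, hx⟩ := exists_isComponent ⟨g, derived_le _ _ hg, hgx⟩
  exact hgx (derived_trivial hG _ G a d le_rfl hfg hc B (Nat.lt_succ_self _)
    (fun g hg s hs => hstart g hg s (hs.2.trans_le le_top)) g hg x hx)

end Solvable
end OrderGerm

namespace PiecewisePSL

/-! ### Möbius action in coordinates -/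

section Mob

theorem det_eq (γ : SL(2, ℤ)) : γ 0 0 * γ 1 1 - γ 0 1 * γ 1 0 = 1 := by
  have := γ.det_coe
  rwa [Matrix.det_fin_two] at this

theorem det_eq_real (γ : SL(2, ℤ)) : (γ 0 0 : ℝ) * γ 1 1 - γ 0 1 * γ 1 0 = 1 := by
  exact_mod_cast det_eq γ

theorem mul_entry (γ δ : SL(2, ℤ)) (i j : Fin 2) :
    (γ * δ) i j = γ i 0 * δ 0 j + γ i 1 * δ 1 j :=
  (Matrix.mul_apply (M := γ.1) (N := δ.1)).trans (Fin.sum_univ_two _)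

theorem mob_mul (γ δ : SL(2, ℤ)) (x : OnePoint ℝ) : mob (γ * δ) x = mob γ (mob δ x) := by
  simp [mob, mul_smul]

theorem mob_one (x : OnePoint ℝ) : mob 1 x = x := by simp [mob]

theorem mob_inv_mob (γ : SL(2, ℤ)) (x : OnePoint ℝ) : mob γ⁻¹ (mob γ x) = x := by
  rw [← mob_mul, inv_mul_cancel, mob_one]

/-- The equality `y = γ x` in terms of the entries of `γ`. -/
theorem coe_eq_mob_iff (γ : SL(2, ℤ)) (x y : ℝ) :
    (y : OnePoint ℝ) = mob γ x ↔ y * (γ 1 0 * x + γ 1 1) = γ 0 0 * x + γ 0 1 := by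
  have hdet := det_eq_real γ
  rw [mob, OnePoint.smul_some_eq_ite]
  simp only [SpecialLinearGroup.mapGL_coe_matrix, SpecialLinearGroup.map_apply_coe,
    RingHom.mapMatrix_apply, Matrix.map_apply, algebraMap_int_eq, eq_intCast]
  split_ifs with h
  · rw [h, mul_zero]
    refine ⟨fun h' => absurd h' (OnePoint.coe_ne_infty y), fun h' => ?_⟩
    exfalso
    have : (γ 0 0 : ℝ) * (γ 1 0 * x + γ 1 1) - γ 1 0 * (γ 0 0 * x + γ 0 1) = 1 := by
      rw [← hdet]; ring
    rw [h, ← h'] at this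
    norm_num at this
  · rw [OnePoint.coe_eq_coe, eq_div_iff h]

theorem mob_infty_iff (γ : SL(2, ℤ)) : mob γ ∞ = ∞ ↔ γ 1 0 = 0 := by
  rw [mob, OnePoint.smul_infty_eq_self_iff]
  simp

theorem mob_neg (γ : SL(2, ℤ)) (x : OnePoint ℝ) : mob (-γ) x = mob γ x := by
  have h : mob (-1) x = x := by
    induction x with
    | infty => rw [mob_infty_iff]; simp
    | coe x => symm; rw [coe_eq_mob_iff]; simp
  rw [← neg_one_mul, mob_mul, ← mob_mul, neg_one_mul, ← mul_neg_one, mob_mul, h]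

theorem eq_one_or_neg_one {γ : SL(2, ℤ)} (h10 : γ 1 0 = 0) (h01 : γ 0 1 = 0)
    (h : γ 0 0 = γ 1 1) : γ = 1 ∨ γ = -1 := by
  have hdet := det_eq γ
  rw [h10, h01, h, mul_zero, sub_zero] at hdet
  rcases Int.mul_eq_one_iff_eq_one_or_neg_one.1 hdet with ⟨h1, -⟩ | ⟨h1, -⟩
  · left
    ext i j
    fin_cases i <;> fin_cases j <;> simp [h10, h01, h, h1]
  · right
    ext i j
    fin_cases i <;> fin_cases j <;> simp [h10, h01, h, h1]

theorem finite_quadratic {a b c : ℝ} (h : ¬(a = 0 ∧ b = 0 ∧ c = 0)) :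
    {x : ℝ | a * x ^ 2 + b * x + c = 0}.Finite := by
  open Polynomial in
  set p : ℝ[X] := C a * X ^ 2 + C b * X + C c with hp
  have hp0 : p ≠ 0 := by
    intro h0
    have h2 := congrArg (fun q => Polynomial.coeff q 2) h0
    have h1 := congrArg (fun q => Polynomial.coeff q 1) h0
    have h0' := congrArg (fun q => Polynomial.coeff q 0) h0
    simp [hp, Polynomial.coeff_X, Polynomial.coeff_C] at h2 h1 h0'
    exact h ⟨h2, h1, h0'⟩
  refine (Polynomial.finite_setOfPred_isRoot hp0).subset fun x hx => ?_
  rw [mem_ofPred_eq] at hx ⊢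
  simpa [Polynomial.IsRoot, hp] using hx

/-- An element of `SL₂(ℤ)` other than `1` and `-1` fixes finitely many points. -/
theorem eq_or_finite_fixed (γ : SL(2, ℤ)) :
    (γ = 1 ∨ γ = -1) ∨ {x : ℝ | (x : OnePoint ℝ) = mob γ x}.Finite := by
  by_cases hz : (γ 1 0 : ℝ) = 0 ∧ (γ 1 1 : ℝ) - γ 0 0 = 0 ∧ -(γ 0 1 : ℝ) = 0
  · refine Or.inl (eq_one_or_neg_one (by exact_mod_cast hz.1)
      (by exact_mod_cast neg_eq_zero.1 hz.2.2) ?_)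
    exact_mod_cast (sub_eq_zero.1 hz.2.1).symm
  · refine Or.inr ((finite_quadratic hz).subset fun x hx => ?_)
    rw [mem_ofPred_eq, coe_eq_mob_iff] at hx
    rw [mem_ofPred_eq]
    linarith

end Mob

/-! ### Point stabilizers in PSL₂(ℤ) are cyclic -/

section Stabilizer

/-- The eigenvalue of `γ` on the vector `(x, 1)`, where `x` is a fixed point. -/
noncomputable def multiplier (x : ℝ) (γ : SL(2, ℤ)) : ℝ := γ 1 0 * x + γ 1 1

/-- An eigenvalue is a root of the characteristic polynomial, whose constant term is the determinant
1. -/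
theorem multiplier_quadratic {x : ℝ} {γ : SL(2, ℤ)} (h : mob γ x = x) :
    multiplier x γ ^ 2 + 1 = (γ 0 0 + γ 1 1 : ℤ) * multiplier x γ := by
  have h' := (coe_eq_mob_iff γ x x).1 h.symm
  have hdet := det_eq_real γ
  simp only [multiplier]
  push_cast
  linear_combination (γ 1 0 : ℝ) * h' - hdet

theorem multiplier_mul {x : ℝ} {γ δ : SL(2, ℤ)} (h : mob δ x = x) :
    multiplier x (γ * δ) = multiplier x γ * multiplier x δ := by
  have h' := (coe_eq_mob_iff δ x x).1 h.symm
  rw [multiplier, multiplier, multiplier, mul_entry, mul_entry]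
  push_cast
  linear_combination -(γ 1 0 : ℝ) * h'

theorem multiplier_ne_zero {x : ℝ} {γ : SL(2, ℤ)} (h : mob γ x = x) : multiplier x γ ≠ 0 := by
  intro h0
  have := multiplier_quadratic h
  rw [h0] at this
  norm_num at this

/-- With an integer eigenvalue, the eigenvector equation is a pair of integral affine relations in
x, and irrationality forces all their coefficients to vanish. -/
theorem eq_one_or_neg_one_of_multiplier {x : ℝ} (hx : Irrational x) {γ : SL(2, ℤ)}
    (h : mob γ x = x) (hm : |multiplier x γ| = 1) : γ = 1 ∨ γ = -1 := by
  have h' := (coe_eq_mob_iff γ x x).1 h.symm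
  have hdet := det_eq_real γ
  obtain ⟨e, he⟩ : ∃ e : ℤ, multiplier x γ = e := by
    rcases eq_or_eq_neg_of_abs_eq hm with h1 | h1
    · exact ⟨1, by simpa using h1⟩
    · exact ⟨-1, by simpa using h1⟩
  have affine : ∀ p q : ℤ, (p : ℝ) * x + q = 0 → p = 0 ∧ q = 0 := by
    intro p q hpq
    have hp : p = 0 := by
      by_contra hp
      refine hx ⟨-q / p, ?_⟩
      have : (p : ℝ) ≠ 0 := by exact_mod_cast hp
      push_cast
      field_simp
      linarith
    subst hp
    simpa using hpq
  have h10 := affine (γ 1 0) (γ 1 1 - e) (by push_cast; rw [← he, multiplier]; ring)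
  change x * multiplier x γ = _ at h'
  have h00 := affine (γ 0 0 - e) (γ 0 1) (by push_cast; rw [← he]; linarith)
  exact eq_one_or_neg_one h10.1 h00.2 (by linarith [h10.2, h00.1])

theorem two_lt_abs_trace {x : ℝ} {γ : SL(2, ℤ)} (h : mob γ x = x)
    (hm : |multiplier x γ| ≠ 1) : 2 < |γ 0 0 + γ 1 1| := by
  have hq := multiplier_quadratic h
  set m := multiplier x γ
  have hm0 : 0 < |m| := abs_pos.2 (multiplier_ne_zero h)
  have habs : |m| ^ 2 + 1 = |((γ 0 0 + γ 1 1 : ℤ) : ℝ)| * |m| := by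
    rw [← abs_mul, ← hq, sq_abs, abs_of_pos (by positivity)]
  have hpos : 0 < (|m| - 1) ^ 2 := by
    have : |m| - 1 ≠ 0 := sub_ne_zero.2 hm
    positivity
  have : (2 : ℝ) < |((γ 0 0 + γ 1 1 : ℤ) : ℝ)| := by
    by_contra! hle
    nlinarith [mul_le_mul_of_nonneg_right hle hm0.le]
  exact_mod_cast this

/-- The trace is an integer of absolute value at least 3, so |m|² + 1 ≥ 3|m|, which has no solution
in (1, 2). This gap makes the group of logarithms of multipliers discrete. -/
theorem two_le_multiplier {x : ℝ} {γ : SL(2, ℤ)} (h : mob γ x = x)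
    (hm : 1 < |multiplier x γ|) : 2 ≤ |multiplier x γ| := by
  have hq := multiplier_quadratic h
  have htr := two_lt_abs_trace h hm.ne'
  set m := multiplier x γ
  have habs : |m| ^ 2 + 1 = |((γ 0 0 + γ 1 1 : ℤ) : ℝ)| * |m| := by
    rw [← abs_mul, ← hq, sq_abs, abs_of_pos (by positivity)]
  have h3 : (3 : ℝ) ≤ |((γ 0 0 + γ 1 1 : ℤ) : ℝ)| := by
    have : 3 ≤ |γ 0 0 + γ 1 1| := htr
    exact_mod_cast this
  nlinarith [mul_le_mul_of_nonneg_right h3 (abs_nonneg m)]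

theorem mem_hyperbolicPoints_or_rational {x : ℝ} {γ : SL(2, ℤ)} (h : mob γ x = x)
    (hγ : ¬(γ = 1 ∨ γ = -1)) : x ∈ hyperbolicPoints ∪ range ((↑) : ℚ → ℝ) := by
  by_cases hx : x ∈ range ((↑) : ℚ → ℝ)
  · exact Or.inr hx
  · refine Or.inl ⟨γ, ?_, h⟩
    rw [Matrix.trace_fin_two]
    exact two_lt_abs_trace h fun hm => hγ (eq_one_or_neg_one_of_multiplier hx h hm)

/-- A subgroup of `SL₂(ℤ)` is cyclic up to sign. -/
def IsCyclicUpToSign (L : Subgroup SL(2, ℤ)) : Prop :=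
  ∃ γ₀ ∈ L, ∀ γ ∈ L, ∃ n : ℤ, γ = γ₀ ^ n ∨ γ = -γ₀ ^ n

theorem isCyclicUpToSign_of_hom {L : Subgroup SL(2, ℤ)} {C : Type*} [Group C] (ψ : L →* C)
    {c : C} (hc : ψ.range = Subgroup.zpowers c)
    (hker : ∀ γ : L, ψ γ = 1 → γ.1 = 1 ∨ γ.1 = -1) : IsCyclicUpToSign L := by
  obtain ⟨γ₀, hγ₀⟩ : c ∈ ψ.range := hc ▸ Subgroup.mem_zpowers c
  refine ⟨γ₀.1, γ₀.2, fun γ hγ => ?_⟩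
  have hmem : ψ ⟨γ, hγ⟩ ∈ Subgroup.zpowers c := hc ▸ ⟨_, rfl⟩
  obtain ⟨n, hn⟩ := Subgroup.mem_zpowers_iff.1 hmem
  refine ⟨n, ?_⟩
  have := hker (⟨γ, hγ⟩ * (γ₀ ^ n)⁻¹) (by rw [map_mul, map_inv, map_zpow, hγ₀, ← hn]; group)
  simp only [Subgroup.coe_mul, Subgroup.coe_inv, Subgroup.coe_zpow, mul_inv_eq_iff_eq_mul] at this
  simpa using this

theorem isCyclicUpToSign_infty {L : Subgroup SL(2, ℤ)} (hL : ∀ γ ∈ L, mob γ ∞ = ∞) :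
    IsCyclicUpToSign L := by
  have hsq : ∀ γ ∈ L, γ 1 0 = 0 ∧ γ 0 0 = γ 1 1 ∧ γ 0 0 * γ 0 0 = 1 := by
    intro γ hγ
    have h10 := (mob_infty_iff γ).1 (hL γ hγ)
    have hdet := det_eq γ
    rw [h10, mul_zero, sub_zero] at hdet
    rcases Int.mul_eq_one_iff_eq_one_or_neg_one.1 hdet with ⟨h1, h2⟩ | ⟨h1, h2⟩ <;>
      simp [h10, h1, h2]
  let ψ : L →* Multiplicative ℤ :=
    -- The diagonal entries are equal and are ±1, so the map is translation by γ 0 1 / γ 0 0, which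
    -- equals this product.
    { toFun := fun γ => Multiplicative.ofAdd (γ.1 0 0 * γ.1 0 1)
      map_one' := by simp
      map_mul' := by
        rintro ⟨γ, hγ⟩ ⟨δ, hδ⟩
        obtain ⟨h1, h2, h3⟩ := hsq γ hγ
        obtain ⟨h1', h2', h3'⟩ := hsq δ hδ
        rw [← ofAdd_add]
        congr 1
        change (γ * δ) 0 0 * (γ * δ) 0 1 = γ 0 0 * γ 0 1 + δ 0 0 * δ 0 1
        rw [mul_entry, mul_entry, h1', ← h2']
        linear_combination δ 0 0 * δ 0 1 * h3 + γ 0 0 * γ 0 1 * h3' }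
  obtain ⟨c, hc⟩ := (Subgroup.isCyclic_iff_exists_zpowers_eq_top ψ.range).1 inferInstance
  refine isCyclicUpToSign_of_hom ψ hc.symm fun γ hγ => ?_
  obtain ⟨h1, h2, h3⟩ := hsq γ.1 γ.2
  have h01 : γ.1 0 0 * γ.1 0 1 = 0 := hγ
  refine eq_one_or_neg_one h1 ?_ h2
  rcases mul_eq_zero.1 h01 with h | h
  · rw [h] at h3; norm_num at h3
  · exact h

theorem isCyclicUpToSign_conj {L : Subgroup SL(2, ℤ)} (σ : SL(2, ℤ))
    (hL : IsCyclicUpToSign (L.comap (MulAut.conj σ).toMonoidHom)) : IsCyclicUpToSign L := by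
  obtain ⟨δ, hδ, h⟩ := hL
  refine ⟨σ * δ * σ⁻¹, hδ, fun γ hγ => ?_⟩
  obtain ⟨n, hn⟩ := h (σ⁻¹ * γ * σ) (by
    rw [Subgroup.mem_comap]
    convert hγ using 1
    simp only [MulEquiv.coe_toMonoidHom, MulAut.conj_apply]
    group)
  refine ⟨n, ?_⟩
  have hγ' : γ = σ * (σ⁻¹ * γ * σ) * σ⁻¹ := by group
  rw [conj_zpow]
  rcases hn with hn | hn
  · left; rw [hγ', hn]
  · right; rw [hγ', hn, mul_neg, neg_mul]

/-- The logarithm of |multiplier| is a homomorphism to ℝ with kernel inside {1, -1}, and its image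
avoids (0, log 2), hence is cyclic. -/
theorem isCyclicUpToSign_irrational {L : Subgroup SL(2, ℤ)} {x : ℝ} (hx : Irrational x)
    (hL : ∀ γ ∈ L, mob γ x = x) : IsCyclicUpToSign L := by
  let ψ : L →* Multiplicative ℝ :=
    { toFun := fun γ => Multiplicative.ofAdd (Real.log |multiplier x γ|)
      map_one' := by simp [multiplier]
      map_mul' := by
        rintro ⟨γ, hγ⟩ ⟨δ, hδ⟩
        rw [← ofAdd_add, ← Real.log_mul (abs_ne_zero.2 (multiplier_ne_zero (hL γ hγ)))
          (abs_ne_zero.2 (multiplier_ne_zero (hL δ hδ))), ← abs_mul,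
          ← multiplier_mul (hL δ hδ)]
        rfl }
  obtain ⟨c, hc⟩ : ∃ c, ψ.range = Subgroup.closure {c} := by
    refine Subgroup.cyclic_of_isolated_one (a := Multiplicative.ofAdd (Real.log 2)) ?_ ?_
    · exact Real.log_pos one_lt_two
    · rw [Set.disjoint_left]
      rintro _ ⟨⟨γ, hγ⟩, rfl⟩ ⟨h1, h2⟩
      change 0 < Real.log |multiplier x γ| at h1
      change Real.log |multiplier x γ| < Real.log 2 at h2
      have hpos : 0 < |multiplier x γ| := abs_pos.2 (multiplier_ne_zero (hL γ hγ))
      rw [Real.log_pos_iff hpos.le] at h1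
      exact absurd ((Real.log_lt_log_iff hpos two_pos).1 h2)
        (not_lt.2 (two_le_multiplier (hL γ hγ) h1))
  rw [← Subgroup.zpowers_eq_closure] at hc
  refine isCyclicUpToSign_of_hom ψ hc fun γ hγ => ?_
  have hlog : Real.log |multiplier x γ| = 0 := hγ
  have hpos : 0 < |multiplier x γ.1| := abs_pos.2 (multiplier_ne_zero (hL γ.1 γ.2))
  exact eq_one_or_neg_one_of_multiplier hx (hL γ.1 γ.2)
    (Real.eq_one_of_pos_of_log_eq_zero hpos hlog)

/-- The stabilizer in `PSL₂(ℤ)` of a point of `ℝ ∪ {∞}` is cyclic, and so are its subgroups. -/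
theorem isCyclicUpToSign {L : Subgroup SL(2, ℤ)} {e : OnePoint ℝ} (hL : ∀ γ ∈ L, mob γ e = e) :
    IsCyclicUpToSign L := by
  have conj_infty : ∀ σ : SL(2, ℤ), mob σ ∞ = e → IsCyclicUpToSign L := by
    intro σ hσ
    refine isCyclicUpToSign_conj σ (isCyclicUpToSign_infty fun δ hδ => ?_)
    have := hL _ hδ
    simp only [MulEquiv.coe_toMonoidHom, MulAut.conj_apply] at this
    rw [← hσ, mob_mul, mob_inv_mob, mob_mul] at this
    rw [← mob_inv_mob σ (mob δ ∞), this, mob_inv_mob]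
  induction e with
  | infty => exact isCyclicUpToSign_infty hL
  | coe x =>
    by_cases hx : x ∈ range ((↑) : ℚ → ℝ)
    · obtain ⟨r, rfl⟩ := hx
      -- SL₂(ℤ) acts transitively on ℚ ∪ {∞}, so a rational point reduces to ∞.
      obtain ⟨σ, hσ⟩ := OnePoint.exists_mem_SL2 ℤ (r : OnePoint ℚ)
      refine conj_infty σ ?_
      have : IsScalarTower ℤ ℚ ℝ := AddCommGroup.intIsScalarTower
      have := congrArg (OnePoint.map (algebraMap ℚ ℝ)) hσ
      rwa [OnePoint.map_smul, OnePoint.map_infty, σ.map_mapGL] at this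
    · exact isCyclicUpToSign_irrational hx hL

end Stabilizer

section Monotone

/-- The difference quotient is 1 / ((cx + d)(cy + d)), and the denominator cx + d keeps a constant
sign on U because it has no zero there. -/
theorem strictMonoOn_of_eq_mob {f : ℝ → ℝ} {γ : SL(2, ℤ)} {U : Set ℝ} (hU : IsPreconnected U)
    (h : ∀ x ∈ U, ((f x : ℝ) : OnePoint ℝ) = mob γ x) : StrictMonoOn f U := by
  have hdet := det_eq_real γ
  have hne : ∀ x ∈ U, (γ 1 0 * x + γ 1 1 : ℝ) ≠ 0 := by
    intro x hx h0
    have hx' := (coe_eq_mob_iff γ x (f x)).1 (h x hx)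
    have : (γ 0 0 : ℝ) * (γ 1 0 * x + γ 1 1) - γ 1 0 * (γ 0 0 * x + γ 0 1) = 1 := by
      rw [← hdet]; ring
    rw [h0, ← hx', h0] at this
    norm_num at this
  intro x hx y hy hxy
  have hfx := (coe_eq_mob_iff γ x (f x)).1 (h x hx)
  have hfy := (coe_eq_mob_iff γ y (f y)).1 (h y hy)
  have hpos : 0 < (γ 1 0 * x + γ 1 1 : ℝ) * (γ 1 0 * y + γ 1 1) := by
    have hcont : ContinuousOn (fun z : ℝ => (γ 1 0 * z + γ 1 1 : ℝ)) U := by fun_prop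
    rcases lt_or_gt_of_ne (hne x hx) with h1 | h1 <;> rcases lt_or_gt_of_ne (hne y hy) with h2 | h2
    · exact mul_pos_of_neg_of_neg h1 h2
    · obtain ⟨z, hz, hz0⟩ := hU.intermediate_value hx hy hcont ⟨h1.le, h2.le⟩
      exact absurd hz0 (hne z hz)
    · obtain ⟨z, hz, hz0⟩ := hU.intermediate_value hy hx hcont ⟨h2.le, h1.le⟩
      exact absurd hz0 (hne z hz)
    · exact mul_pos h1 h2
  have key : (f y - f x) * ((γ 1 0 * x + γ 1 1 : ℝ) * (γ 1 0 * y + γ 1 1)) = y - x := by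
    linear_combination (γ 1 0 * x + γ 1 1 : ℝ) * hfy - (γ 1 0 * y + γ 1 1 : ℝ) * hfx +
      (y - x) * hdet
  have : 0 < f y - f x := pos_of_mul_pos_left (by rw [key]; linarith) hpos.le
  linarith

theorem strictMono_of_isPiecewisePSL {f : ℝ ≃ₜ ℝ} (hf : IsPiecewisePSL f) : StrictMono f := by
  refine (f.continuous.strictMono_of_inj f.injective).resolve_right fun hanti => ?_
  obtain ⟨S, hS, h⟩ := hf
  obtain ⟨m, hm⟩ := hS.bddAbove
  have hU : Ioi m ⊆ Sᶜ := fun x hx hxS => absurd (hm hxS) (not_le.2 hx)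
  obtain ⟨γ, hγ⟩ := h (Ioi m) isPreconnected_Ioi hU
  have hmono := strictMonoOn_of_eq_mob isPreconnected_Ioi hγ
  have h1 : m + 1 ∈ Ioi m := by simp
  have h2 : m + 2 ∈ Ioi m := by simp
  have hlt : m + 1 < m + 2 := by linarith
  exact lt_asymm (hmono h1 h2 hlt) (hanti hlt)

end Monotone

/-! ### One-sided germs of piecewise projective maps -/

section Germs

/-- The filters of one-sided neighborhoods of the points `e` of `ℝ ∪ {∞}`: they have connected
members that avoid any given finite set. -/
structure IsGermFilter (l : Filter ℝ) (e : OnePoint ℝ) : Prop where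
  neBot : l.NeBot
  tendsto : Tendsto ((↑) : ℝ → OnePoint ℝ) l (𝓝 e)
  exists_preconnected : ∀ S : Set ℝ, S.Finite → ∃ U ∈ l, IsPreconnected U ∧ U ⊆ Sᶜ

theorem isGermFilter_nhdsGT (x : ℝ) : IsGermFilter (𝓝[>] x) x where
  neBot := inferInstance
  tendsto := (OnePoint.continuous_coe.tendsto x).mono_left nhdsWithin_le_nhds
  exists_preconnected S hS := by
    have h : Sᶜ ∈ 𝓝[>] x := by
      have h1 : (S \ {x})ᶜ ∈ 𝓝[>] x :=
        mem_nhdsWithin_of_mem_nhds (hS.sdiff.isClosed.isOpen_compl.mem_nhds (by simp))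
      filter_upwards [h1, self_mem_nhdsWithin] with z hz hxz hzS
      exact hz ⟨hzS, ne_of_gt hxz⟩
    obtain ⟨u, hu, hsub⟩ := mem_nhdsGT_iff_exists_Ioo_subset.1 h
    exact ⟨Ioo x u, Ioo_mem_nhdsGT hu, isPreconnected_Ioo, hsub⟩

theorem isGermFilter_nhdsLT (x : ℝ) : IsGermFilter (𝓝[<] x) x where
  neBot := inferInstance
  tendsto := (OnePoint.continuous_coe.tendsto x).mono_left nhdsWithin_le_nhds
  exists_preconnected S hS := by
    have h : Sᶜ ∈ 𝓝[<] x := by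
      have h1 : (S \ {x})ᶜ ∈ 𝓝[<] x :=
        mem_nhdsWithin_of_mem_nhds (hS.sdiff.isClosed.isOpen_compl.mem_nhds (by simp))
      filter_upwards [h1, self_mem_nhdsWithin] with z hz hxz hzS
      exact hz ⟨hzS, ne_of_lt hxz⟩
    obtain ⟨u, hu, hsub⟩ := mem_nhdsLT_iff_exists_Ioo_subset.1 h
    exact ⟨Ioo u x, Ioo_mem_nhdsLT hu, isPreconnected_Ioo, hsub⟩

theorem isGermFilter_atTop : IsGermFilter atTop ∞ where
  neBot := inferInstance
  tendsto := OnePoint.tendsto_coe_infty.mono_left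
    (by rw [coclosedCompact_eq_cocompact]; exact atTop_le_cocompact)
  exists_preconnected S hS := by
    obtain ⟨m, hm⟩ := hS.bddAbove
    exact ⟨Ioi m, Ioi_mem_atTop m, isPreconnected_Ioi,
      fun x hx hxS => absurd (hm hxS) (not_le.2 hx)⟩

theorem isGermFilter_atBot : IsGermFilter atBot ∞ where
  neBot := inferInstance
  tendsto := OnePoint.tendsto_coe_infty.mono_left
    (by rw [coclosedCompact_eq_cocompact]; exact atBot_le_cocompact)
  exists_preconnected S hS := by
    obtain ⟨m, hm⟩ := hS.bddBelow
    exact ⟨Iio m, Iio_mem_atBot m, isPreconnected_Iio,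
      fun x hx hxS => absurd (hm hxS) (not_le.2 hx)⟩

variable {l : Filter ℝ} {e : OnePoint ℝ}

theorem IsGermFilter.eventually_notMem (hl : IsGermFilter l e) {S : Set ℝ} (hS : S.Finite) :
    ∀ᶠ x in l, x ∉ S := by
  obtain ⟨U, hU, -, hUS⟩ := hl.exists_preconnected S hS
  filter_upwards [hU] with x hx using hUS hx

theorem IsGermFilter.exists_mob (hl : IsGermFilter l e) {f : ℝ ≃ₜ ℝ} (hf : IsPiecewisePSL f) :
    ∃ γ : SL(2, ℤ), ∀ᶠ x in l, ((f x : ℝ) : OnePoint ℝ) = mob γ x := by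
  obtain ⟨S, hS, h⟩ := hf
  obtain ⟨U, hU, hUc, hUS⟩ := hl.exists_preconnected S hS
  obtain ⟨γ, hγ⟩ := h U hUc hUS
  exact ⟨γ, by filter_upwards [hU] with x hx using hγ x hx⟩

theorem IsGermFilter.mob_fixed (hl : IsGermFilter l e) {f : ℝ → ℝ} (hf : Tendsto f l l)
    {γ : SL(2, ℤ)} (hγ : ∀ᶠ x in l, ((f x : ℝ) : OnePoint ℝ) = mob γ x) : mob γ e = e := by
  have := hl.neBot
  have hlin : ∀ᶠ x in l, f x * (γ 1 0 * x + γ 1 1) = γ 0 0 * x + γ 0 1 :=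
    hγ.mono fun x hx => (coe_eq_mob_iff γ x (f x)).1 hx
  have hle := tendsto_iff_comap.1 hl.tendsto
  induction e with
  | infty =>
    rw [OnePoint.comap_coe_nhds_infty, coclosedCompact_eq_cocompact] at hle
    have hinv : Tendsto (fun x : ℝ => x⁻¹) l (𝓝 0) := by
      rw [← Metric.cobounded_eq_cocompact] at hle
      exact tendsto_inv₀_cobounded.mono_left hle
    have hne : ∀ᶠ x in l, x ≠ 0 := hl.eventually_notMem (finite_singleton 0)
    rw [mob_infty_iff]
    -- Dividing the relation f(x)(cx + d) = ax + b by x f(x) gives c + d/x = (a + b/x)/f(x), and the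
    -- limit is c = 0.
    have h1 : Tendsto (fun x : ℝ => (γ 1 0 + γ 1 1 * x⁻¹ : ℝ)) l (𝓝 (γ 1 0 + γ 1 1 * 0)) :=
      tendsto_const_nhds.add (tendsto_const_nhds.mul hinv)
    have h2 : Tendsto (fun x : ℝ => (f x)⁻¹ * (γ 0 0 + γ 0 1 * x⁻¹ : ℝ)) l
        (𝓝 (0 * (γ 0 0 + γ 0 1 * 0))) :=
      (hinv.comp hf).mul (tendsto_const_nhds.add (tendsto_const_nhds.mul hinv))
    have h3 := tendsto_nhds_unique_of_eventuallyEq h1 h2 (by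
      filter_upwards [hlin, hne, hf.eventually hne] with x hx hx0 hfx0
      field_simp
      linarith)
    simpa using h3
  | coe x₀ =>
    rw [OnePoint.comap_coe_nhds] at hle
    symm
    rw [coe_eq_mob_iff]
    have hid : Tendsto (fun x : ℝ => x) l (𝓝 x₀) := hle
    refine tendsto_nhds_unique_of_eventuallyEq (f := fun x => f x * (γ 1 0 * x + γ 1 1))
      ((hid.comp hf).mul ((tendsto_const_nhds.mul hid).add tendsto_const_nhds))
      ((tendsto_const_nhds.mul hid).add tendsto_const_nhds) hlin

theorem mob_of_eq_one_or_neg_one {γ : SL(2, ℤ)} (h : γ = 1 ∨ γ = -1) (x : OnePoint ℝ) :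
    mob γ x = x := by
  rcases h with rfl | rfl
  · exact mob_one x
  · rw [mob_neg, mob_one]

theorem IsGermFilter.eq_one_or_neg_one (hl : IsGermFilter l e) {f : ℝ → ℝ} {γ : SL(2, ℤ)}
    (hγ : ∀ᶠ x in l, ((f x : ℝ) : OnePoint ℝ) = mob γ x) (hf : ∀ᶠ x in l, f x = x) :
    γ = 1 ∨ γ = -1 := by
  have := hl.neBot
  refine (eq_or_finite_fixed γ).resolve_right fun hfin => ?_
  obtain ⟨x, h1, h2, h3⟩ := (hγ.and (hf.and (hl.eventually_notMem hfin))).exists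
  exact h3 (by rw [mem_ofPred_eq, ← h1, h2])

theorem IsGermFilter.dichotomy (hl : IsGermFilter l e) {f : ℝ ≃ₜ ℝ} (hf : IsPiecewisePSL f) :
    (∀ᶠ x in l, f x = x) ∨ ∀ᶠ x in l, f x ≠ x := by
  obtain ⟨γ, hγ⟩ := hl.exists_mob hf
  rcases eq_or_finite_fixed γ with h | h
  · left
    filter_upwards [hγ] with x hx
    rwa [mob_of_eq_one_or_neg_one h, OnePoint.coe_eq_coe] at hx
  · right
    filter_upwards [hγ, hl.eventually_notMem h] with x hx hxS hfx
    exact hxS (by rw [← hx, hfx])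

/-- The group of germs along `l` of a group of piecewise projective maps is cyclic. -/
theorem IsGermFilter.cyclic (hl : IsGermFilter l e) (H : Subgroup piecewiseGroup)
    (hH : ∀ f ∈ H, Tendsto f.1 l l) :
    ∃ h ∈ H, ∀ g ∈ H, ∃ n : ℤ, ∀ᶠ x in l, g.1 x = (h ^ n).1 x := by
  -- Pairing each map with every matrix that induces its germ avoids choosing a sign; the projection
  -- of R to the matrices fixes e.
  let R : Subgroup (piecewiseGroup × SL(2, ℤ)) :=
    { carrier := {p | p.1 ∈ H ∧ ∀ᶠ x in l, ((p.1.1 x : ℝ) : OnePoint ℝ) = mob p.2 x}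
      one_mem' := ⟨H.one_mem, Eventually.of_forall fun x => (mob_one x).symm⟩
      mul_mem' := by
        rintro ⟨f, γ⟩ ⟨g, δ⟩ ⟨hf, hfγ⟩ ⟨hg, hgδ⟩
        refine ⟨H.mul_mem hf hg, ?_⟩
        filter_upwards [(hH g hg).eventually hfγ, hgδ] with x h1 h2
        change ((f.1 (g.1 x) : ℝ) : OnePoint ℝ) = mob (γ * δ) x
        rw [mob_mul, ← h2, h1]
      inv_mem' := by
        rintro ⟨f, γ⟩ ⟨hf, hfγ⟩
        refine ⟨H.inv_mem hf, ?_⟩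
        filter_upwards [(hH f⁻¹ (H.inv_mem hf)).eventually hfγ] with x h1
        change ((f.1.symm x : ℝ) : OnePoint ℝ) = mob γ⁻¹ x
        have h2 : f.1 ((f⁻¹).1 x) = x := f.1.apply_symm_apply x
        change ((f.1 ((f⁻¹).1 x) : ℝ) : OnePoint ℝ) = mob γ ((f.1.symm x : ℝ) : OnePoint ℝ) at h1
        rw [h2] at h1
        rw [h1, mob_inv_mob] }
  obtain ⟨γ₀, ⟨⟨h, γ⟩, hR, rfl⟩, hcyc⟩ :=
    isCyclicUpToSign (L := R.map (MonoidHom.snd _ _)) (e := e) (by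
      rintro _ ⟨⟨f, γ⟩, ⟨hf, hfγ⟩, rfl⟩
      exact hl.mob_fixed (hH f hf) hfγ)
  refine ⟨h, hR.1, fun g hg => ?_⟩
  obtain ⟨δ, hδ⟩ := hl.exists_mob g.2
  obtain ⟨n, hn⟩ := hcyc δ ⟨(g, δ), ⟨hg, hδ⟩, rfl⟩
  refine ⟨n, ?_⟩
  filter_upwards [hδ, (R.zpow_mem hR n).2] with x h1 h2
  have hmob : mob δ x = mob (γ ^ n) x := by
    rcases hn with rfl | rfl
    · rfl
    · exact mob_neg _ _
  rw [hmob] at h1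
  exact OnePoint.coe_injective (h1.trans h2.symm)

end Germs

/-! ### Starts: their arithmetic nature and finiteness of their orbits -/

section Starts

/-- A point at which a piecewise projective map starts to be different from the identity is fixed by
an element of `PSL₂(ℤ)` that is hyperbolic or parabolic. -/
theorem start_mem {g : ℝ ≃ₜ ℝ} (hg : IsPiecewisePSL g) {s : ℝ} (hgs : g s = s)
    (hs : ∀ᶠ x in 𝓝[>] s, g x ≠ x) : s ∈ hyperbolicPoints ∪ range ((↑) : ℚ → ℝ) := by
  have hl := isGermFilter_nhdsGT s
  obtain ⟨γ, hγ⟩ := hl.exists_mob hg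
  have htend : Tendsto g (𝓝[>] s) (𝓝[>] s) := by
    refine tendsto_nhdsWithin_iff.2 ⟨?_, ?_⟩
    · have := g.continuous.tendsto s
      rw [hgs] at this
      exact this.mono_left nhdsWithin_le_nhds
    · filter_upwards [self_mem_nhdsWithin] with z hz
      rw [← hgs]; exact strictMono_of_isPiecewisePSL hg hz
  refine mem_hyperbolicPoints_or_rational (hl.mob_fixed htend hγ) fun h => ?_
  obtain ⟨x, h1, h2⟩ := (hγ.and hs).exists
  rw [mob_of_eq_one_or_neg_one h, OnePoint.coe_eq_coe] at h1
  exact h2 h1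

/-- `f` is projective on a neighborhood of `x`. -/
def IsSmoothAt (f : ℝ ≃ₜ ℝ) (x : ℝ) : Prop :=
  ∃ γ : SL(2, ℤ), ∀ᶠ z in 𝓝 x, ((f z : ℝ) : OnePoint ℝ) = mob γ z

theorem finite_not_isSmoothAt {f : ℝ ≃ₜ ℝ} (hf : IsPiecewisePSL f) :
    {x | ¬IsSmoothAt f x}.Finite := by
  obtain ⟨S, hS, h⟩ := hf
  refine hS.subset fun x hx => ?_
  by_contra hxS
  obtain ⟨ε, hε, hball⟩ := Metric.isOpen_iff.1 hS.isClosed.isOpen_compl x hxS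
  obtain ⟨γ, hγ⟩ := h _ (convex_ball x ε).isPreconnected hball
  exact hx ⟨γ, by filter_upwards [Metric.ball_mem_nhds x hε] with z hz using hγ z hz⟩

/-- In a finitely generated group the starts of all elements fall into finitely many orbits. -/
theorem exists_finset_starts {H : Subgroup (ℝ ≃ₜ ℝ)} (hH : H ≤ piecewiseGroup) (hfg : H.FG) :
    ∃ B : Finset ℝ, ∀ g ∈ H, ∀ s : ℝ, (∀ᶠ x in 𝓝[<] s, g x = x) →
      (∀ᶠ x in 𝓝[>] s, g x ≠ x) → ∃ b ∈ B, ∃ h ∈ H, s = h b := by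
  obtain ⟨F, hF, hfin⟩ := (Subgroup.fg_iff H).1 hfg
  have hFH : ∀ f ∈ F, f ∈ H := fun f hf => by rw [← hF]; exact Subgroup.subset_closure hf
  have hBfin : (⋃ f ∈ F, {x | ¬IsSmoothAt f x}).Finite :=
    hfin.biUnion fun f hf => finite_not_isSmoothAt (hH (hFH f hf))
  refine ⟨hBfin.toFinset, fun g hg s hleft hright => ?_⟩
  by_contra! hcon
  have hgen : ∀ f ∈ F, ∀ h ∈ H, IsSmoothAt f (h s) := by
    intro f hf h hh
    by_contra hns
    refine hcon (h s) (hBfin.mem_toFinset.2 (mem_biUnion hf hns)) h⁻¹ (H.inv_mem hh) ?_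
    exact (h.symm_apply_apply s).symm
  have hall : ∀ f ∈ Subgroup.closure F, ∀ h ∈ H, IsSmoothAt f (h s) := by
    intro f hf
    induction hf using Subgroup.closure_induction with
    | mem f hf => exact hgen f hf
    | one => exact fun h _ => ⟨1, Eventually.of_forall fun z => (mob_one z).symm⟩
    | mul f f' hf hf' ih ih' =>
      intro h hh
      obtain ⟨δ, hδ⟩ := ih' h hh
      obtain ⟨γ, hγ⟩ := ih (f' * h) (H.mul_mem (by rwa [← hF]) hh)
      refine ⟨γ * δ, ?_⟩
      filter_upwards [hδ, (f'.continuous.tendsto (h s)).eventually hγ] with z h1 h2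
      change ((f (f' z) : ℝ) : OnePoint ℝ) = _
      rw [mob_mul, ← h1, h2]
    | inv f hf ih =>
      intro h hh
      obtain ⟨γ, hγ⟩ := ih (f⁻¹ * h) (H.mul_mem (H.inv_mem (by rwa [← hF])) hh)
      refine ⟨γ⁻¹, ?_⟩
      filter_upwards [(f.symm.continuous.tendsto (h s)).eventually hγ] with z h1
      change ((f.symm z : ℝ) : OnePoint ℝ) = _
      rw [f.apply_symm_apply] at h1
      rw [h1, mob_inv_mob]
  -- If the orbit of s avoids the breakpoints of all generators, every word in them is given by one
  -- matrix near s. For g this matrix is ±1 by the left side, contradicting the right side.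
  obtain ⟨γ, hγ⟩ := hall g (by rwa [hF]) 1 H.one_mem
  change ∀ᶠ z in 𝓝 s, _ at hγ
  have h1 := (isGermFilter_nhdsLT s).eq_one_or_neg_one (hγ.filter_mono nhdsWithin_le_nhds) hleft
  obtain ⟨x, hx, hx'⟩ := ((hγ.filter_mono nhdsWithin_le_nhds).and hright).exists
  rw [mob_of_eq_one_or_neg_one h1, OnePoint.coe_eq_coe] at hx
  exact hx' hx

end Starts

/-! ### Passage to the extended line -/

section Extension

/-- A piecewise projective homeomorphism of the line as an order isomorphism. -/
noncomputable def realOrderIso (f : piecewiseGroup) : ℝ ≃o ℝ where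
  toEquiv := f.1.toEquiv
  map_rel_iff' := (strictMono_of_isPiecewisePSL f.2).le_iff_le

/-- The action of the piecewise projective group on the extended line `[-∞, ∞]`. -/
noncomputable def extend : piecewiseGroup →* (EReal ≃o EReal) where
  toFun f := ((realOrderIso f).withTopCongr.withBotCongr : WithBot (WithTop ℝ) ≃o WithBot (WithTop ℝ))
  map_one' := by
    ext x
    induction x using EReal.rec <;> rfl
  map_mul' f g := by
    ext x
    induction x using EReal.rec <;> rfl

theorem extend_coe (f : piecewiseGroup) (x : ℝ) : extend f x = (f.1 x : ℝ) := rfl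

theorem extend_injective : Function.Injective extend := by
  intro f g h
  refine Subtype.ext (Homeomorph.ext fun x => ?_)
  have := congrArg (fun φ : EReal ≃o EReal => φ x) h
  simpa [extend_coe] using this

theorem nhdsGT_coe (x : ℝ) : 𝓝[>] (x : EReal) = map ((↑) : ℝ → EReal) (𝓝[>] x) := by
  rw [← EReal.isOpenEmbedding_coe.map_nhdsWithin_preimage_eq]
  congr 2
  ext y; simp

theorem nhdsLT_coe (x : ℝ) : 𝓝[<] (x : EReal) = map ((↑) : ℝ → EReal) (𝓝[<] x) := by
  rw [← EReal.isOpenEmbedding_coe.map_nhdsWithin_preimage_eq]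
  congr 2
  ext y; simp

theorem nhdsGT_eq_bot_or_map (a : EReal) :
    𝓝[>] a = ⊥ ∨ ∃ l e, IsGermFilter l e ∧ 𝓝[>] a = map ((↑) : ℝ → EReal) l := by
  induction a with
  | bot =>
    refine Or.inr ⟨atBot, ∞, isGermFilter_atBot, ?_⟩
    rw [← EReal.nhdsWithin_bot, Ioi_bot]
  | coe x => exact Or.inr ⟨_, _, isGermFilter_nhdsGT x, nhdsGT_coe x⟩
  | top => left; simp

theorem nhdsLT_eq_bot_or_map (a : EReal) :
    𝓝[<] a = ⊥ ∨ ∃ l e, IsGermFilter l e ∧ 𝓝[<] a = map ((↑) : ℝ → EReal) l := by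
  induction a with
  | bot => left; simp
  | coe x => exact Or.inr ⟨_, _, isGermFilter_nhdsLT x, nhdsLT_coe x⟩
  | top =>
    refine Or.inr ⟨atTop, ∞, isGermFilter_atTop, ?_⟩
    rw [← EReal.nhdsWithin_top, Iio_top]

theorem extend_dichotomy {m : Filter EReal}
    (hm : m = ⊥ ∨ ∃ l e, IsGermFilter l e ∧ m = map ((↑) : ℝ → EReal) l) (f : piecewiseGroup) :
    (∀ᶠ z in m, extend f z = z) ∨ ∀ᶠ z in m, extend f z ≠ z := by
  rcases hm with rfl | ⟨l, e, hl, rfl⟩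
  · left; simp
  · simpa [eventually_map, extend_coe] using hl.dichotomy f.2

theorem extend_cyclic {m : Filter EReal}
    (hm : m = ⊥ ∨ ∃ l e, IsGermFilter l e ∧ m = map ((↑) : ℝ → EReal) l)
    {K : Subgroup (EReal ≃o EReal)} (hK : K ≤ extend.range) (hKm : ∀ g ∈ K, Tendsto g m m) :
    ∃ h ∈ K, ∀ g ∈ K, ∃ n : ℤ, ∀ᶠ z in m, g z = (h ^ n) z := by
  rcases hm with rfl | ⟨l, e, hl, rfl⟩
  · exact ⟨1, K.one_mem, fun g _ => ⟨0, by simp⟩⟩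
  · obtain ⟨h, hh, hgen⟩ := hl.cyclic (K.comap extend) fun f hf => by
      have h1 := hKm _ hf
      rw [tendsto_map'_iff] at h1
      have h2 : map ((↑) : ℝ → EReal) (map f.1 l) ≤ map ((↑) : ℝ → EReal) l := h1
      exact (map_le_map_iff EReal.coe_injective).1 h2
    refine ⟨extend h, hh, fun g hg => ?_⟩
    obtain ⟨f, rfl⟩ := hK hg
    obtain ⟨n, hn⟩ := hgen f hg
    refine ⟨n, ?_⟩
    rw [eventually_map]
    filter_upwards [hn] with x hx
    rw [← map_zpow, extend_coe, extend_coe, hx]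

end Extension

/-! ### From a violation of tameness to a chain configuration -/

section Chain

open OrderGerm in
/-- The orbits of `f` in an interval without fixed points accumulate at the right end. -/
theorem exists_zpow_mem {f : piecewiseGroup} {s q b : ℝ} (hf : ∀ z ∈ Ico s q, f.1 z ≠ z)
    (hfq : f.1 q = q) (hsq : s < q) (hbq : b < q) : ∃ n : ℤ, b < (f.1 ^ n) s ∧ (f.1 ^ n) s < q := by
  obtain ⟨a, d, hc, hs⟩ := exists_isComponent (H := Subgroup.zpowers (extend f)) (x := (s : EReal))
    ⟨_, Subgroup.mem_zpowers _, by
      rw [extend_coe, Ne, EReal.coe_eq_coe_iff]; exact hf s ⟨le_rfl, hsq⟩⟩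
  have hfix : ∀ z, extend f z = z → z ∉ Ioo a d := fun z hz hmem => by
    obtain ⟨g, hg, hgz⟩ := hc.moved z hmem
    obtain ⟨n, rfl⟩ := Subgroup.mem_zpowers_iff.1 hg
    exact hgz (zpow_fixed hz n)
  have hdq : d ≤ q := by
    by_contra! hlt
    exact hfix q (by rw [extend_coe, hfq]) ⟨hs.1.trans (EReal.coe_lt_coe_iff.2 hsq), hlt⟩
  have hqd : (q : EReal) ≤ d := by
    by_contra! hlt
    have hdd := hc.right_fixed _ (Subgroup.mem_zpowers _)
    have hds := hs.2
    induction d with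
    | bot => exact absurd hds not_lt_bot
    | top => exact absurd hlt not_top_lt
    | coe d =>
      rw [extend_coe, EReal.coe_eq_coe_iff] at hdd
      exact hf d ⟨(EReal.coe_lt_coe_iff.1 hds).le, EReal.coe_lt_coe_iff.1 hlt⟩ hdd
  obtain rfl : d = q := le_antisymm hdq hqd
  have hn : ∃ n : ℤ, (b : EReal) < (extend f ^ n) s := by
    rcases moves_same_direction fun z hz hfz => hfix z hfz hz with hpos | hneg
    · obtain ⟨n, hn⟩ := exists_lt_pow hpos hs (EReal.coe_lt_coe_iff.2 hbq)
      exact ⟨n, by simpa using hn⟩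
    · obtain ⟨n, hn⟩ := exists_lt_pow (h := (extend f)⁻¹) (fun z hz => by
        have hmem := (Subgroup.zpowers (extend f)).inv_mem (Subgroup.mem_zpowers _)
        have := hneg _ (mem_Ioo_of_fixed (hc.left_fixed _ hmem) (hc.right_fixed _ hmem) hz)
        rwa [RelIso.apply_inv_self] at this) hs (EReal.coe_lt_coe_iff.2 hbq)
      exact ⟨-n, by simpa using hn⟩
  obtain ⟨n, hn⟩ := hn
  have hmem := Subgroup.zpow_mem _ (Subgroup.mem_zpowers (extend f)) n
  have hlt := (mem_Ioo_of_fixed (hc.left_fixed _ hmem) (hc.right_fixed _ hmem) hs).2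
  rw [← map_zpow, extend_coe, EReal.coe_lt_coe_iff] at hn hlt
  exact ⟨n, by simpa using hn, by simpa using hlt⟩

/-- Take c = q and for b the last fixed point of g in [s, q]. The orbit of s under f accumulates at
q, so some power brings s into (b, q). -/
theorem exists_isChainConfiguration {f g : piecewiseGroup} {s q : ℝ} (hsq : s < q)
    (hleft : ∀ᶠ z in 𝓝[<] s, g.1 z = z) (hright : ∀ᶠ z in 𝓝[>] s, g.1 z ≠ z)
    (hf : ∀ z ∈ Ico s q, f.1 z ≠ z) (hfq : f.1 q = q) (hgq : g.1 q ≠ q) :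
    ∃ b c s : ℝ, IsChainConfiguration f.1 g.1 b c s := by
  have hclosed : IsClosed {x | g.1 x = x} := isClosed_eq g.1.continuous continuous_id
  obtain ⟨r, hr, hrsub⟩ := mem_nhdsLT_iff_exists_Ioo_subset.1 hleft
  obtain ⟨t, ht, htsub⟩ := mem_nhdsGT_iff_exists_Ioo_subset.1 hright
  rw [mem_Iio] at hr
  rw [mem_Ioi] at ht
  have hgs : g.1 s = s := by
    have : closure (Ioo r s) ⊆ {x | g.1 x = x} := closure_minimal hrsub hclosed
    rw [closure_Ioo hr.ne] at this
    exact this ⟨hr.le, le_rfl⟩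
  have hcomp : IsCompact (Icc s q ∩ {x | g.1 x = x}) := isCompact_Icc.inter_right hclosed
  have hne : (Icc s q ∩ {x | g.1 x = x}).Nonempty := ⟨s, ⟨le_rfl, hsq.le⟩, hgs⟩
  obtain ⟨b, ⟨hb, hgb⟩, hmax⟩ := hcomp.exists_isGreatest hne
  have hbq : b < q := lt_of_le_of_ne hb.2 fun h => hgq (by rw [← h]; exact hgb)
  obtain ⟨n, hn, hn'⟩ := exists_zpow_mem hf hfq hsq hbq
  refine ⟨b, q, s, hbq, hgb, hfq, fun x hx hgx => ?_, fun x hx => hf x ⟨hb.1.trans hx.1, hx.2⟩,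
    start_mem g.2 hgs hright, hb.1, ⟨n, hn.le, hn'.le⟩, min (s - r) (t - s) / 2, ?_,
    fun ε hε hε' => ?_⟩
  · exact absurd (hmax ⟨⟨hb.1.trans hx.1.le, hx.2⟩, hgx⟩) (not_le.2 hx.1)
  · have := sub_pos.2 hr
    have := sub_pos.2 ht
    positivity
  · have h1 : min (s - r) (t - s) ≤ s - r := min_le_left _ _
    have h2 : min (s - r) (t - s) ≤ t - s := min_le_right _ _
    exact ⟨hrsub ⟨by linarith, by linarith⟩, htsub ⟨by linarith, by linarith⟩⟩

open OrderGerm in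
theorem isTame_of_not_chain {H : Subgroup piecewiseGroup}
    (h : ¬∃ f ∈ H, ∃ g ∈ H, ∃ b c s : ℝ, IsChainConfiguration f.1 g.1 b c s) :
    IsTame (H.map extend) where
  right_dichotomy := by
    rintro _ ⟨g, -, rfl⟩ a -
    exact extend_dichotomy (nhdsGT_eq_bot_or_map a) g
  left_dichotomy := by
    rintro _ ⟨g, -, rfl⟩ a -
    exact extend_dichotomy (nhdsLT_eq_bot_or_map a) g
  right_cyclic K hK a ha := extend_cyclic (nhdsGT_eq_bot_or_map a)
    (hK.trans (Subgroup.map_le_range _ _)) fun g hg => tendsto_nhdsGT (ha g hg)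
  left_cyclic K hK a ha := extend_cyclic (nhdsLT_eq_bot_or_map a)
    (hK.trans (Subgroup.map_le_range _ _)) fun g hg => tendsto_nhdsLT (ha g hg)
  not_chain := by
    rintro _ ⟨f, hf, rfl⟩ _ ⟨g, hg, rfl⟩ s q hsq ⟨hbot, hleft, hright⟩ hmove hfq
    induction q with
    | bot => exact absurd hsq not_lt_bot
    -- At infinity the condition is automatic, so only a real q can yield a configuration.
    | top => exact OrderIso.map_top _
    | coe q =>
      induction s with
      | bot => exact absurd hbot (lt_irrefl _)
      | top => exact absurd hsq not_top_lt
      | coe s =>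
        rw [nhdsLT_coe, eventually_map] at hleft
        rw [nhdsGT_coe, eventually_map] at hright
        simp only [extend_coe, EReal.coe_eq_coe_iff, Ne] at hleft hright hfq ⊢
        by_contra hgq
        refine h ⟨f, hf, g, hg, exists_isChainConfiguration (EReal.coe_lt_coe_iff.1 hsq) hleft
          hright (fun z hz hfz => ?_) hfq hgq⟩
        exact hmove z ⟨EReal.coe_le_coe_iff.2 hz.1, EReal.coe_lt_coe_iff.2 hz.2⟩
          (by rw [extend_coe, hfz])

end Chain

end PiecewisePSL

open PiecewisePSL OrderGerm in
-- The extension to `EReal` is faithful, so it suffices to treat its image, where all starts are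
-- real: `IsStart` excludes `⊥` and the top end is excluded separately.
theorem PiecewisePSL.isSolvable_of_not_chain {H : Subgroup (ℝ ≃ₜ ℝ)} (hH : H ≤ piecewiseGroup)
    (hfg : H.FG)
    (h : ¬∃ f ∈ H, ∃ g ∈ H, ∃ b c s : ℝ, IsChainConfiguration f g b c s) : Group.IsSolvable H := by
  set φ := extend.comp (Subgroup.inclusion hH) with hφ
  have hrange : φ.range = (H.subgroupOf piecewiseGroup).map extend := by
    rw [hφ, MonoidHom.range_comp, Subgroup.inclusion_range]
  have hG : IsTame φ.range := hrange ▸ isTame_of_not_chain fun ⟨f, hf, g, hg, hcfg⟩ =>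
    h ⟨f.1, hf, g.1, hg, hcfg⟩
  have : Group.FG H := (Group.fg_iff_subgroup_fg H).2 hfg
  have hGfg : φ.range.FG := (Group.fg_iff_subgroup_fg _).1 inferInstance
  obtain ⟨B, hB⟩ := exists_finset_starts hH hfg
  have hsolv : Group.IsSolvable φ.range := by
    refine OrderGerm.isSolvable hG hGfg (B.map ⟨_, EReal.coe_injective⟩) ?_
    rintro _ ⟨g, rfl⟩ s hs ⟨hbot, hleft, hright⟩
    induction s with
    | bot => exact absurd hbot (lt_irrefl _)
    | top => exact absurd hs (lt_irrefl _)
    | coe s =>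
      rw [nhdsLT_coe, eventually_map] at hleft
      rw [nhdsGT_coe, eventually_map] at hright
      simp only [hφ, MonoidHom.comp_apply, extend_coe, EReal.coe_eq_coe_iff, Ne] at hleft hright
      obtain ⟨b, hb, k, hk, rfl⟩ := hB g.1 g.2 s hleft hright
      exact ⟨b, Finset.mem_map_of_mem _ hb, φ ⟨k, hk⟩, ⟨_, rfl⟩, rfl⟩
  have hinj : Function.Injective φ :=
    extend_injective.comp (Subgroup.inclusion_injective hH)
  exact Group.isSolvable_of_isSolvable_injective (f := φ.rangeRestrict)
    (MonoidHom.rangeRestrict_injective_iff.2 hinj)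

end

theorem lemma7p1 (H : Subgroup (ℝ ≃ₜ ℝ)) (hH : H ≤ PiecewisePSL.piecewiseGroup) (hfg : H.FG) :
    Group.IsSolvable H ∨
      ∃ f ∈ H, ∃ g ∈ H, ∃ b c s : ℝ, PiecewisePSL.IsChainConfiguration f g b c s := by
  by_contra! h
  exact h.1 (PiecewisePSL.isSolvable_of_not_chain hH hfg fun ⟨f, hf, g, hg, b, c, s, hcfg⟩ =>
    h.2 f hf g hg b c s hcfg)
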